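/- Let $A\in\mathbb{R}^{n\times n}$ be invertible, $B\in\mathbb{R}^{n\times m}$, let $Q\in\mathbb{R}^{n\times n}$ and $R\in\mathbb{R}^{m\times m}$ be symmetric positive definite, and let $\gamma>0$. Write $|x|_M^2=x^\top Mx$, $|x|^2=x^\top x$, $\|C\|_M^2=\operatorname{tr}(C^\top MC)$, $\langle C,D\rangle=\operatorname{tr}(C^\top D)$, and $\mathrm{sat}(y)=\max\{-1,\min\{1,y\}\}$. Game. For an initial state $x_0\in\mathbb{R}^n$ consider the value $$\inf_\mu\ \sup_{w,i,N}\ \sum_{t=0}^N\left(|x_t|_Q^2+|u_t|_R^2-\gamma^2|w_t|^2\right)\in[-\infty,\infty],\qquad(1)$$ where $i\in\{-1,1\}$, $w_t\in\mathbb{R}^n$, $N\ge0$, and $x_{t+1}=iAx_t+Bu_t+w_t$, $u_t=\mu_t(x_0,\dots,x_t,u_0,\dots,u_{t-1})$, the $\mu_t$ being arbitrary functions. Bellman iterations. For $V:\mathbb{R}^n\times\mathbb{R}^{2n\times2n}\to[-\infty,\infty]$ let $$\mathcal{F}V(x,Z)=\inf_{u\in\mathbb{R}^m}\sup_{v\in\mathbb{R}^n}\left\{|x|_Q^2+|u|_R^2+V\left(v,\,Z+\begin{bmatrix}Bu-v\\x\end{bmatrix}\begin{bmatrix}Bu-v\\x\end{bmatrix}^\top\right)\right\}.$$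 Put $V_0(x,Z)=-\gamma^2\min_{i=\pm1}\|[I\ \ iA]^\top\|_Z^2$ and $V_{k+1}=\mathcal{F}V_k$. For a symmetric matrix $P$ put $\bar V_0(x,Z)=|x|_P^2-\gamma^2\min_{i=\pm1}\|[I\ \ iA]^\top\|_Z^2$ and $\bar V_{k+1}=\mathcal{F}\bar V_k$. Riccati equation. Let $P$ with $0\prec P\prec\gamma^2I$ satisfy $$|x|_P^2=\min_u\max_v\left\{|x|_Q^2+|u|_R^2-\gamma^2|Ax+Bu-v|^2+|v|_P^2\right\}\quad\text{for all }x\in\mathbb{R}^n,\qquad(2)$$ with minimizing argument $u=-Kx$, $K\in\mathbb{R}^{m\times n}$. Let $T:=Q+A^\top(P^{-1}-\gamma^{-2}I)^{-1}A$ and assume that $T-P$ is invertible. Then the following two conditions are equivalent: (i) the value (1) is finite for every $x_0$, and $\bar V_k(x,Z)=\bar V_1(x,Z)$ for all $k\ge1$, all $x\in\mathbb{R}^n$ and all positive semi-definite $Z\in\mathbb{R}^{2n\times2n}$; (ii) $(\gamma^2I-P)(T-P)^{-1}(\gamma^2I-P)\succeq(I\pm BKA^{-1})(\gamma^2I-P)(I\pm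 BKA^{-1})^\top$ for both the "$+$" and the "$-$" sign. Moreover, suppose that (i) and (ii) hold and that $P$ is the least solution of (2), that is, $P\preceq P'$ for every solution $P'$ of (2) with $0\prec P'\prec\gamma^2I$. Then the control law $$u_t=\mathrm{sat}\left(\frac{\gamma^2\sum_{\tau=0}^{t-1}(Bu_\tau-x_{\tau+1})^\top Ax_\tau}{|x_t|^2_{T-P}}\right)Kx_t$$ (read as $u_t=0$ if $x_t=0$) attains the infimum in (1) for every $x_0$, and, for all $x\in\mathbb{R}^n$ and all positive semi-definite $Z\in\mathbb{R}^{2n\times2n}$, with $Y:=\gamma^2[I\ \ 0]\,Z\,[0\ \ I]^\top$, the limit $V_*(x,Z)=\lim_{k\to\infty}V_k(x,Z)$ exists and equals $$V_*(x,Z)=\begin{cases}|x|_P^2-\gamma^2\min_{i=\pm1}\|[I\ \ iA]^\top\|_Z^2&\text{if }|\langle A,Y\rangle|\ge|x|_{T-P}^2,\\[1mm]|x|_T^2-\gamma^2\|\mathrm{diag}\{I,A\}^\top\|_Z^2+\dfrac{\langle A,Y\rangle^2}{|x|_{T-P}^2}&\text{otherwise.}\end{cases}$$ -/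

import Mathlib

open Matrix

noncomputable section

namespace SignGame

variable {n m : ℕ}

/-- `|x|²_M = xᵀ M x`. -/
def qf {k : ℕ} (M : Matrix (Fin k) (Fin k) ℝ) (x : Fin k → ℝ) : ℝ := x ⬝ᵥ (M *ᵥ x)

/-- `‖C‖²_M = tr (Cᵀ M C)`. -/
def matSq {ι κ : Type} [Fintype ι] [Fintype κ] (C : Matrix ι κ ℝ) (M : Matrix ι ι ℝ) : ℝ :=
  (Cᵀ * M * C).trace

/-- The saturation function. -/
def sat (y : ℝ) : ℝ := if 1 < y then 1 else if y < -1 then -1 else y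

/-! ### The game -/

/-- A control law: `u_t = μ_t (x_0, …, x_t, u_0, …, u_{t-1})`. -/
abbrev ControlLaw (n m : ℕ) : Type :=
  (t : ℕ) → (Fin (t + 1) → Fin n → ℝ) → (Fin t → Fin m → ℝ) → Fin m → ℝ

/-- `x, u` are generated from `x₀`, the sign `i` and the disturbance `w` by the plant
`x_{t+1} = i A x_t + B u_t + w_t` and the control law `μ`. -/
def IsTrajectory (A : Matrix (Fin n) (Fin n) ℝ) (B : Matrix (Fin n) (Fin m) ℝ)
    (μ : ControlLaw n m) (x₀ : Fin n → ℝ) (i : ℝ) (w : ℕ → Fin n → ℝ)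
    (x : ℕ → Fin n → ℝ) (u : ℕ → Fin m → ℝ) : Prop :=
  x 0 = x₀ ∧
  (∀ t, x (t + 1) = i • (A *ᵥ x t) + B *ᵥ u t + w t) ∧
  (∀ t, u t = μ t (fun τ => x τ) (fun τ => u τ))

/-- The cost `∑_{t=0}^N (|x_t|²_Q + |u_t|²_R - γ² |w_t|²)`. -/
def cost (Q : Matrix (Fin n) (Fin n) ℝ) (R : Matrix (Fin m) (Fin m) ℝ) (γ : ℝ)
    (w x : ℕ → Fin n → ℝ) (u : ℕ → Fin m → ℝ) (N : ℕ) : ℝ :=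
  ∑ t ∈ Finset.range (N + 1), (qf Q (x t) + qf R (u t) - γ ^ 2 * (w t ⬝ᵥ w t))

/-- The supremum of the cost over `w`, `i ∈ {-1, 1}` and `N ≥ 0` under the control law `μ`. -/
def worstCost (A : Matrix (Fin n) (Fin n) ℝ) (B : Matrix (Fin n) (Fin m) ℝ)
    (Q : Matrix (Fin n) (Fin n) ℝ) (R : Matrix (Fin m) (Fin m) ℝ) (γ : ℝ)
    (μ : ControlLaw n m) (x₀ : Fin n → ℝ) : EReal :=
  sSup {c : EReal | ∃ (i : ℝ) (w x : ℕ → Fin n → ℝ) (u : ℕ → Fin m → ℝ) (N : ℕ),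
    (i = 1 ∨ i = -1) ∧ IsTrajectory A B μ x₀ i w x u ∧ c = (cost Q R γ w x u N : EReal)}

/-- The value of the game with initial state `x₀`. -/
def gameValue (A : Matrix (Fin n) (Fin n) ℝ) (B : Matrix (Fin n) (Fin m) ℝ)
    (Q : Matrix (Fin n) (Fin n) ℝ) (R : Matrix (Fin m) (Fin m) ℝ) (γ : ℝ)
    (x₀ : Fin n → ℝ) : EReal :=
  ⨅ μ : ControlLaw n m, worstCost A B Q R γ μ x₀

/-- `μ` attains the infimum for every initial state. -/
def IsOptimal (A : Matrix (Fin n) (Fin n) ℝ) (B : Matrix (Fin n) (Fin m) ℝ)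
    (Q : Matrix (Fin n) (Fin n) ℝ) (R : Matrix (Fin m) (Fin m) ℝ) (γ : ℝ)
    (μ : ControlLaw n m) : Prop :=
  ∀ x₀, worstCost A B Q R γ μ x₀ = gameValue A B Q R γ x₀

/-! ### The Bellman operator -/

/-- The matrices `Z` collecting the data, of size `2n × 2n` in `n × n` blocks. -/
abbrev ZMat (n : ℕ) : Type := Matrix (Fin n ⊕ Fin n) (Fin n ⊕ Fin n) ℝ

/-- `Z + [Bu - v; x] [Bu - v; x]ᵀ`. -/
def updateZ (B : Matrix (Fin n) (Fin m) ℝ) (x : Fin n → ℝ) (Z : ZMat n)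
    (u : Fin m → ℝ) (v : Fin n → ℝ) : ZMat n :=
  Z + vecMulVec (Sum.elim (B *ᵥ u - v) x) (Sum.elim (B *ᵥ u - v) x)

/-- The Bellman operator, on extended-real-valued functions. -/
def bellman (B : Matrix (Fin n) (Fin m) ℝ)
    (Q : Matrix (Fin n) (Fin n) ℝ) (R : Matrix (Fin m) (Fin m) ℝ)
    (V : (Fin n → ℝ) → ZMat n → EReal) (x : Fin n → ℝ) (Z : ZMat n) : EReal :=
  ⨅ u : Fin m → ℝ, ⨆ v : Fin n → ℝ,
    ((qf Q x + qf R u : ℝ) : EReal) + V v (updateZ B x Z u v)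

/-- `min_{i = ±1} ‖[I  iA]ᵀ‖²_Z`. -/
def minSign (A : Matrix (Fin n) (Fin n) ℝ) (Z : ZMat n) : ℝ :=
  min (matSq (fromCols (1 : Matrix (Fin n) (Fin n) ℝ) A)ᵀ Z)
    (matSq (fromCols (1 : Matrix (Fin n) (Fin n) ℝ) (-A))ᵀ Z)

/-- The iterates `V_k`, starting from `V_0(x,Z) = -γ² min_i ‖[I  iA]ᵀ‖²_Z`. -/
def V (A : Matrix (Fin n) (Fin n) ℝ) (B : Matrix (Fin n) (Fin m) ℝ)
    (Q : Matrix (Fin n) (Fin n) ℝ) (R : Matrix (Fin m) (Fin m) ℝ) (γ : ℝ) :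
    ℕ → (Fin n → ℝ) → ZMat n → EReal
  | 0 => fun _ Z => ((-(γ ^ 2 * minSign A Z) : ℝ) : EReal)
  | k + 1 => bellman B Q R (V A B Q R γ k)

/-- The iterates `V̄_k`, starting from `V̄_0(x,Z) = |x|²_P - γ² min_i ‖[I  iA]ᵀ‖²_Z`. -/
def Vbar (A : Matrix (Fin n) (Fin n) ℝ) (B : Matrix (Fin n) (Fin m) ℝ)
    (Q : Matrix (Fin n) (Fin n) ℝ) (R : Matrix (Fin m) (Fin m) ℝ) (γ : ℝ)
    (P : Matrix (Fin n) (Fin n) ℝ) : ℕ → (Fin n → ℝ) → ZMat n → EReal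
  | 0 => fun x Z => ((qf P x - γ ^ 2 * minSign A Z : ℝ) : EReal)
  | k + 1 => bellman B Q R (Vbar A B Q R γ P k)

/-! ### The Riccati equation -/

/-- `max_v {|x|²_Q + |u|²_R - γ² |Ax + Bu - v|² + |v|²_P}`. -/
def riccatiMax (A : Matrix (Fin n) (Fin n) ℝ) (B : Matrix (Fin n) (Fin m) ℝ)
    (Q : Matrix (Fin n) (Fin n) ℝ) (R : Matrix (Fin m) (Fin m) ℝ) (γ : ℝ)
    (P : Matrix (Fin n) (Fin n) ℝ) (x : Fin n → ℝ) (u : Fin m → ℝ) : EReal :=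
  ⨆ v : Fin n → ℝ, ((qf Q x + qf R u
    - γ ^ 2 * ((A *ᵥ x + B *ᵥ u - v) ⬝ᵥ (A *ᵥ x + B *ᵥ u - v)) + qf P v : ℝ) : EReal)

/-- `P` solves the Riccati equation and `0 ≺ P ≺ γ² I`. -/
def IsRiccatiSolution (A : Matrix (Fin n) (Fin n) ℝ) (B : Matrix (Fin n) (Fin m) ℝ)
    (Q : Matrix (Fin n) (Fin n) ℝ) (R : Matrix (Fin m) (Fin m) ℝ) (γ : ℝ)
    (P : Matrix (Fin n) (Fin n) ℝ) : Prop :=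
  P.PosDef ∧ (γ ^ 2 • (1 : Matrix (Fin n) (Fin n) ℝ) - P).PosDef ∧
  ∀ x, (qf P x : EReal) = ⨅ u : Fin m → ℝ, riccatiMax A B Q R γ P x u

/-- `u = -K x` is a minimizing argument in the Riccati equation, for every `x`. -/
def IsRiccatiGain (A : Matrix (Fin n) (Fin n) ℝ) (B : Matrix (Fin n) (Fin m) ℝ)
    (Q : Matrix (Fin n) (Fin n) ℝ) (R : Matrix (Fin m) (Fin m) ℝ) (γ : ℝ)
    (P : Matrix (Fin n) (Fin n) ℝ) (K : Matrix (Fin m) (Fin n) ℝ) : Prop :=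
  ∀ x u, riccatiMax A B Q R γ P x (-(K *ᵥ x)) ≤ riccatiMax A B Q R γ P x u

/-- `P` is the least solution of the Riccati equation between `0` and `γ² I`
(in the order of symmetric matrices). -/
def IsLeastRiccatiSolution (A : Matrix (Fin n) (Fin n) ℝ) (B : Matrix (Fin n) (Fin m) ℝ)
    (Q : Matrix (Fin n) (Fin n) ℝ) (R : Matrix (Fin m) (Fin m) ℝ) (γ : ℝ)
    (P : Matrix (Fin n) (Fin n) ℝ) : Prop :=
  IsRiccatiSolution A B Q R γ P ∧
  ∀ P', IsRiccatiSolution A B Q R γ P' → (P' - P).PosSemidef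

/-- `T = Q + Aᵀ (P⁻¹ - γ⁻² I)⁻¹ A`. -/
def Tmat (A Q : Matrix (Fin n) (Fin n) ℝ) (γ : ℝ) (P : Matrix (Fin n) (Fin n) ℝ) :
    Matrix (Fin n) (Fin n) ℝ :=
  Q + Aᵀ * (P⁻¹ - (γ ^ 2)⁻¹ • (1 : Matrix (Fin n) (Fin n) ℝ))⁻¹ * A

/-! ### The two conditions, the control law and the value function -/

/-- The value is finite for every initial state, and `V̄_k = V̄_1` for `k ≥ 1`. -/
def ConditionI (A : Matrix (Fin n) (Fin n) ℝ) (B : Matrix (Fin n) (Fin m) ℝ)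
    (Q : Matrix (Fin n) (Fin n) ℝ) (R : Matrix (Fin m) (Fin m) ℝ) (γ : ℝ)
    (P : Matrix (Fin n) (Fin n) ℝ) : Prop :=
  (∀ x₀, gameValue A B Q R γ x₀ ≠ ⊤ ∧ gameValue A B Q R γ x₀ ≠ ⊥) ∧
  ∀ k, 1 ≤ k → ∀ (x : Fin n → ℝ) (Z : ZMat n), Z.PosSemidef →
    Vbar A B Q R γ P k x Z = Vbar A B Q R γ P 1 x Z

/-- The matrix inequality, for both signs `ε = ±1`, with `G = γ² I - P`. -/
def ConditionII (A : Matrix (Fin n) (Fin n) ℝ) (B : Matrix (Fin n) (Fin m) ℝ)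
    (Q : Matrix (Fin n) (Fin n) ℝ) (γ : ℝ)
    (P : Matrix (Fin n) (Fin n) ℝ) (K : Matrix (Fin m) (Fin n) ℝ) : Prop :=
  let G : Matrix (Fin n) (Fin n) ℝ := γ ^ 2 • (1 : Matrix (Fin n) (Fin n) ℝ) - P
  ∀ ε : ℝ, ε = 1 ∨ ε = -1 →
    (G * (Tmat A Q γ P - P)⁻¹ * G
      - (1 + ε • (B * K * A⁻¹)) * G * (1 + ε • (B * K * A⁻¹))ᵀ).PosSemidef

/-- The control law
`u_t = sat (γ² ∑_{τ<t} (B u_τ - x_{τ+1})ᵀ A x_τ / |x_t|²_{T-P}) K x_t`. When `x_t = 0` the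
quotient is irrelevant, since then `K x_t = 0`. -/
def satLaw (A : Matrix (Fin n) (Fin n) ℝ) (B : Matrix (Fin n) (Fin m) ℝ)
    (Q : Matrix (Fin n) (Fin n) ℝ) (γ : ℝ)
    (P : Matrix (Fin n) (Fin n) ℝ) (K : Matrix (Fin m) (Fin n) ℝ) : ControlLaw n m :=
  fun t x u =>
    sat (γ ^ 2 * (∑ τ : Fin t, (B *ᵥ u τ - x τ.succ) ⬝ᵥ (A *ᵥ x τ.castSucc))
      / qf (Tmat A Q γ P - P) (x (Fin.last t))) • (K *ᵥ x (Fin.last t))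

/-- `⟨A, Y⟩ = tr (Aᵀ Y)`, where `Y = γ² [I 0] Z [0 I]ᵀ` is `γ²` times the upper right block
of `Z`. -/
def innerAY (A : Matrix (Fin n) (Fin n) ℝ) (γ : ℝ) (Z : ZMat n) : ℝ :=
  (Aᵀ * (γ ^ 2 • Z.toBlocks₁₂)).trace

open Classical in
/-- The piecewise formula for the value function. -/
def Vstar (A Q : Matrix (Fin n) (Fin n) ℝ) (γ : ℝ) (P : Matrix (Fin n) (Fin n) ℝ)
    (x : Fin n → ℝ) (Z : ZMat n) : ℝ :=
  if qf (Tmat A Q γ P - P) x ≤ |innerAY A γ Z| then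
    qf P x - γ ^ 2 * minSign A Z
  else
    qf (Tmat A Q γ P) x
      - γ ^ 2 * matSq (fromBlocks (1 : Matrix (Fin n) (Fin n) ℝ) 0 0 A)ᵀ Z
      + innerAY A γ Z ^ 2 / qf (Tmat A Q γ P - P) x

end SignGame

end

/-!
For a fixed plant sign the game is a linear-quadratic one. The worse of the two signs costs at least
the average over a random sign of mean `σ ∈ [-1, 1]`, which bounds every Bellman iterate from below
by a quadratic function of the state that is affine in `y = ⟨A, Y⟩`. Maximizing over `σ` gives the
value `concealed P x y` of the game in which the sign is revealed after one step, and the minimizing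
input of that step is the Riccati feedback scaled by the saturated ratio `y / |x|²_{T-P}`.

Both `V̄₁` and the proposed limit are this function, so everything depends on whether it is a
supersolution of the Bellman equation. One step with the saturated input turns this into the
inequality `MixtureBound` of quadratic forms, for each saturation level `θ` and each mean `σ`. After
completing squares it involves only `θ²` and a cross term linear in `θ σ`, and the extreme case
`θ = 1`, `σ → ±1` is the matrix inequality. Conversely, `V̄₂ = V̄₁` at data with
`y = |x|²_{T-P}`, where the input saturates, recovers that case.

The iterates `V_k` start from `P = 0`, and the Riccati iteration from `0` increases to the least
solution. Averaging over signs along this iteration gives the matching lower bounds both for the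
limit of `V_k` and for the value of the game.
-/

noncomputable section

open Filter Topology

namespace SignGame

variable {n m : ℕ}

/-! ### Quadratic forms -/

section QuadraticForms

lemma dotProduct_mulVec_comm {ι : Type*} [Fintype ι] {M : Matrix ι ι ℝ} (hM : M.IsSymm)
    (x y : ι → ℝ) : x ⬝ᵥ (M *ᵥ y) = y ⬝ᵥ (M *ᵥ x) := by
  rw [← dotProduct_transpose_mulVec, hM.eq]

lemma mulVec_inv_mulVec {ι : Type*} [Fintype ι] [DecidableEq ι] {M : Matrix ι ι ℝ}
    (hM : IsUnit M) (x : ι → ℝ) : M *ᵥ (M⁻¹ *ᵥ x) = x := by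
  rw [mulVec_mulVec, mul_nonsing_inv _ ((isUnit_iff_isUnit_det _).1 hM), one_mulVec]

lemma inv_mulVec_mulVec {ι : Type*} [Fintype ι] [DecidableEq ι] {M : Matrix ι ι ℝ}
    (hM : IsUnit M) (x : ι → ℝ) : M⁻¹ *ᵥ (M *ᵥ x) = x := by
  rw [mulVec_mulVec, nonsing_inv_mul _ ((isUnit_iff_isUnit_det _).1 hM), one_mulVec]

lemma isSymm_conj {ι κ : Type*} [Fintype ι] {M : Matrix ι ι ℝ} (hM : M.IsSymm)
    (C : Matrix ι κ ℝ) : (Cᵀ * M * C).IsSymm := by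
  simp only [IsSymm, transpose_mul, transpose_transpose, hM.eq, Matrix.mul_assoc]

lemma isSymm_of_posSemidef {ι : Type*} {M : Matrix ι ι ℝ} (hM : M.PosSemidef) : M.IsSymm :=
  isHermitian_iff_isSymm.1 hM.isHermitian

lemma isSymm_of_posDef {ι : Type*} {M : Matrix ι ι ℝ} (hM : M.PosDef) : M.IsSymm :=
  isHermitian_iff_isSymm.1 hM.isHermitian

variable {k l : ℕ} {M N : Matrix (Fin k) (Fin k) ℝ}

lemma qf_zero (M : Matrix (Fin k) (Fin k) ℝ) : qf M 0 = 0 := by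
  rw [qf, zero_dotProduct]

lemma qf_one (x : Fin k → ℝ) : qf 1 x = x ⬝ᵥ x := by
  rw [qf, one_mulVec]

lemma qf_neg (x : Fin k → ℝ) : qf M (-x) = qf M x := by
  simp only [qf, mulVec_neg, neg_dotProduct_neg]

lemma qf_smul (c : ℝ) (x : Fin k → ℝ) : qf M (c • x) = c ^ 2 * qf M x := by
  simp only [qf, mulVec_smul, smul_dotProduct, dotProduct_smul, smul_eq_mul]
  ring

lemma qf_add (hM : M.IsSymm) (x y : Fin k → ℝ) :
    qf M (x + y) = qf M x + 2 * (x ⬝ᵥ (M *ᵥ y)) + qf M y := by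
  simp only [qf, mulVec_add, add_dotProduct, dotProduct_add]
  rw [dotProduct_mulVec_comm hM y x]
  ring

lemma qf_sub (hM : M.IsSymm) (x y : Fin k → ℝ) :
    qf M (x - y) = qf M x - 2 * (x ⬝ᵥ (M *ᵥ y)) + qf M y := by
  rw [sub_eq_add_neg, qf_add hM, qf_neg, mulVec_neg, dotProduct_neg]
  ring

lemma qf_matrix_zero (x : Fin k → ℝ) : qf 0 x = 0 := by
  rw [qf, zero_mulVec, dotProduct_zero]

lemma qf_matrix_add (M N : Matrix (Fin k) (Fin k) ℝ) (x : Fin k → ℝ) :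
    qf (M + N) x = qf M x + qf N x := by
  simp only [qf, add_mulVec, dotProduct_add]

lemma qf_matrix_sub (M N : Matrix (Fin k) (Fin k) ℝ) (x : Fin k → ℝ) :
    qf (M - N) x = qf M x - qf N x := by
  simp only [qf, sub_mulVec, dotProduct_sub]

lemma qf_matrix_smul (c : ℝ) (M : Matrix (Fin k) (Fin k) ℝ) (x : Fin k → ℝ) :
    qf (c • M) x = c * qf M x := by
  simp only [qf, smul_mulVec, dotProduct_smul, smul_eq_mul]

lemma qf_conj (C : Matrix (Fin k) (Fin l) ℝ) (x : Fin l → ℝ) :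
    qf (Cᵀ * M * C) x = qf M (C *ᵥ x) := by
  simp only [qf, ← mulVec_mulVec, dotProduct_transpose_mulVec]
  exact dotProduct_comm _ _

lemma qf_nonneg (hM : M.PosSemidef) (x : Fin k → ℝ) : 0 ≤ qf M x :=
  hM.dotProduct_mulVec_nonneg x

lemma qf_pos (hM : M.PosDef) {x : Fin k → ℝ} (hx : x ≠ 0) : 0 < qf M x :=
  hM.dotProduct_mulVec_pos hx

lemma posSemidef_of_qf_nonneg (hM : M.IsSymm) (h : ∀ x, 0 ≤ qf M x) : M.PosSemidef :=
  PosSemidef.of_dotProduct_mulVec_nonneg (isHermitian_iff_isSymm.2 hM) h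

lemma posDef_of_qf_pos (hM : M.IsSymm) (h : ∀ x, x ≠ 0 → 0 < qf M x) : M.PosDef :=
  PosDef.of_dotProduct_mulVec_pos (isHermitian_iff_isSymm.2 hM) fun x hx => h x hx

lemma eq_of_qf_eq (hM : M.IsSymm) (hN : N.IsSymm) (h : ∀ x, qf M x = qf N x) : M = N := by
  ext i j
  have hij := h (Pi.single i 1 + Pi.single j 1)
  rw [qf_add hM, qf_add hN, h, h] at hij
  simpa using hij

lemma qf_inv_mulVec (hM : M.PosDef) (x : Fin k → ℝ) : qf M (M⁻¹ *ᵥ x) = qf M⁻¹ x := by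
  rw [qf, mulVec_inv_mulVec hM.isUnit, qf, dotProduct_comm]

lemma two_mul_dotProduct_mulVec_le (hM : M.PosSemidef) (x y : Fin k → ℝ) :
    2 * (x ⬝ᵥ (M *ᵥ y)) ≤ qf M x + qf M y := by
  have h := qf_nonneg hM (x - y)
  rw [qf_sub (isSymm_of_posSemidef hM)] at h
  linarith

lemma two_mul_dotProduct_le (hM : M.PosDef) (x y : Fin k → ℝ) :
    2 * (x ⬝ᵥ y) ≤ qf M x + qf M⁻¹ y := by
  simpa only [mulVec_inv_mulVec hM.isUnit, qf_inv_mulVec hM]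
    using two_mul_dotProduct_mulVec_le hM.posSemidef x (M⁻¹ *ᵥ y)

lemma sq_dotProduct_le (hM : M.PosDef) (x y : Fin k → ℝ) :
    (x ⬝ᵥ y) ^ 2 ≤ qf M x * qf M⁻¹ y := by
  have hquad : ∀ t : ℝ, 0 ≤ qf M⁻¹ y * (t * t) + -(2 * (x ⬝ᵥ y)) * t + qf M x := fun t => by
    have h := two_mul_dotProduct_le hM x (t • y)
    rw [qf_smul, dotProduct_smul, smul_eq_mul] at h
    linarith
  have hdiscrim := discrim_le_zero hquad
  rw [discrim] at hdiscrim
  linarith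

lemma tendsto_of_tendsto_qf_sub {ι : Type*} {f : Filter ι} (hM : M.PosDef) {u : ι → Fin k → ℝ}
    {x : Fin k → ℝ} (h : Tendsto (fun j => qf M (u j - x)) f (𝓝 0)) : Tendsto u f (𝓝 x) := by
  refine tendsto_pi_nhds.2 fun i => tendsto_iff_norm_sub_tendsto_zero.2 ?_
  have hbound : Tendsto (fun j => qf M (u j - x) * qf M⁻¹ (Pi.single i 1)) f (𝓝 0) := by
    simpa only [zero_mul] using h.mul_const _
  have hsq : Tendsto (fun j => (u j i - x i) ^ 2) f (𝓝 0) := by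
    refine squeeze_zero (fun j => sq_nonneg _) (fun j => ?_) hbound
    simpa only [dotProduct_single, mul_one, Pi.sub_apply]
      using sq_dotProduct_le hM (u j - x) (Pi.single i 1)
  simpa only [Real.norm_eq_abs, Real.sqrt_sq_eq_abs, Real.sqrt_zero] using hsq.sqrt

lemma continuous_qf (M : Matrix (Fin k) (Fin k) ℝ) : Continuous (qf M) := by
  unfold qf
  fun_prop

lemma continuous_qf_matrix (x : Fin k → ℝ) :
    Continuous fun M : Matrix (Fin k) (Fin k) ℝ => qf M x := by
  unfold qf
  fun_prop

end QuadraticForms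

/-! ### The Riccati operator -/

/-- The gap `G = γ² I - P`, positive definite exactly when `P ≺ γ² I`. -/
def gapMatrix (γ : ℝ) (P : Matrix (Fin n) (Fin n) ℝ) : Matrix (Fin n) (Fin n) ℝ :=
  γ ^ 2 • (1 : Matrix (Fin n) (Fin n) ℝ) - P

/-- The matrix `M = γ⁴ G⁻¹ - γ² I` of the worst case `|p|²_M = max_v {|v|²_P - γ² |p - v|²}`.
It equals `(P⁻¹ - γ⁻² I)⁻¹` for invertible `P`, but also makes sense for the singular `P = 0` at
which the Riccati iteration starts. -/
def worstMatrix (γ : ℝ) (P : Matrix (Fin n) (Fin n) ℝ) : Matrix (Fin n) (Fin n) ℝ :=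
  (γ ^ 2) ^ 2 • (gapMatrix γ P)⁻¹ - γ ^ 2 • (1 : Matrix (Fin n) (Fin n) ℝ)

/-- The Hessian `S = R + Bᵀ M B` of the worst-case cost with respect to the input. -/
def inputMatrix (B : Matrix (Fin n) (Fin m) ℝ) (R : Matrix (Fin m) (Fin m) ℝ) (γ : ℝ)
    (P : Matrix (Fin n) (Fin n) ℝ) : Matrix (Fin m) (Fin m) ℝ :=
  R + Bᵀ * worstMatrix γ P * B

/-- The Riccati gain `S⁻¹ Bᵀ M A`; the minimizing input is `-gain *ᵥ x`. -/
def gain (A : Matrix (Fin n) (Fin n) ℝ) (B : Matrix (Fin n) (Fin m) ℝ)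
    (R : Matrix (Fin m) (Fin m) ℝ) (γ : ℝ) (P : Matrix (Fin n) (Fin n) ℝ) :
    Matrix (Fin m) (Fin n) ℝ :=
  (inputMatrix B R γ P)⁻¹ * (Bᵀ * worstMatrix γ P * A)

/-- The weight `|K x|²_S` of the Riccati feedback `-K x`, by which it lowers the worst-case cost of
the input `u = 0`. -/
def gainCost (A : Matrix (Fin n) (Fin n) ℝ) (B : Matrix (Fin n) (Fin m) ℝ)
    (R : Matrix (Fin m) (Fin m) ℝ) (γ : ℝ) (P : Matrix (Fin n) (Fin n) ℝ) (x : Fin n → ℝ) : ℝ :=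
  qf (inputMatrix B R γ P) (gain A B R γ P *ᵥ x)

/-- The worst-case cost matrix `Q + Aᵀ M A` of the input `u = 0`; this is `Tmat` for invertible
`P`. -/
def openLoop (A Q : Matrix (Fin n) (Fin n) ℝ) (γ : ℝ) (P : Matrix (Fin n) (Fin n) ℝ) :
    Matrix (Fin n) (Fin n) ℝ :=
  Q + Aᵀ * worstMatrix γ P * A

/-- The Riccati operator, whose fixed points solve the Riccati equation. -/
def riccatiOp (A : Matrix (Fin n) (Fin n) ℝ) (B : Matrix (Fin n) (Fin m) ℝ)
    (Q : Matrix (Fin n) (Fin n) ℝ) (R : Matrix (Fin m) (Fin m) ℝ) (γ : ℝ)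
    (P : Matrix (Fin n) (Fin n) ℝ) : Matrix (Fin n) (Fin n) ℝ :=
  openLoop A Q γ P - (gain A B R γ P)ᵀ * inputMatrix B R γ P * gain A B R γ P

/-- The cost matrices `0 ⪯ P ≺ γ² I` for which the worst-case disturbance exists. -/
def IsAdmissible (γ : ℝ) (P : Matrix (Fin n) (Fin n) ℝ) : Prop :=
  P.PosSemidef ∧ (gapMatrix γ P).PosDef

section Riccati

variable (A : Matrix (Fin n) (Fin n) ℝ) (B : Matrix (Fin n) (Fin m) ℝ)
  (Q : Matrix (Fin n) (Fin n) ℝ) {R : Matrix (Fin m) (Fin m) ℝ} {γ : ℝ}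
  {P P' : Matrix (Fin n) (Fin n) ℝ}

lemma isSymm_gapMatrix (hP : P.IsSymm) : (gapMatrix γ P).IsSymm :=
  (isSymm_one.smul _).sub hP

lemma isSymm_worstMatrix (hP : P.IsSymm) : (worstMatrix γ P).IsSymm :=
  ((isSymm_gapMatrix hP).inv.smul _).sub (isSymm_one.smul _)

lemma isSymm_openLoop {Q : Matrix (Fin n) (Fin n) ℝ} (hQ : Q.IsSymm) (hP : P.IsSymm) :
    (openLoop A Q γ P).IsSymm :=
  hQ.add (isSymm_conj (isSymm_worstMatrix hP) A)

lemma isSymm_riccatiOp {Q : Matrix (Fin n) (Fin n) ℝ} (hQ : Q.IsSymm) (hR : R.IsSymm)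
    (hP : P.IsSymm) : (riccatiOp A B Q R γ P).IsSymm :=
  (isSymm_openLoop A hQ hP).sub
    (isSymm_conj (hR.add (isSymm_conj (isSymm_worstMatrix hP) B)) _)

lemma qf_gapMatrix (v : Fin n → ℝ) : qf (gapMatrix γ P) v = γ ^ 2 * (v ⬝ᵥ v) - qf P v := by
  rw [gapMatrix, qf_matrix_sub, qf_matrix_smul, qf_one]

lemma qf_worstMatrix (p : Fin n → ℝ) :
    qf (worstMatrix γ P) p = (γ ^ 2) ^ 2 * qf (gapMatrix γ P)⁻¹ p - γ ^ 2 * (p ⬝ᵥ p) := by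
  rw [worstMatrix, qf_matrix_sub, qf_matrix_smul, qf_matrix_smul, qf_one]

lemma qf_openLoop (x : Fin n → ℝ) :
    qf (openLoop A Q γ P) x = qf Q x + qf (worstMatrix γ P) (A *ᵥ x) := by
  rw [openLoop, qf_matrix_add, qf_conj]

lemma qf_inputMatrix (u : Fin m → ℝ) :
    qf (inputMatrix B R γ P) u = qf R u + qf (worstMatrix γ P) (B *ᵥ u) := by
  rw [inputMatrix, qf_matrix_add, qf_conj]

lemma qf_riccatiOp (x : Fin n → ℝ) :
    qf (riccatiOp A B Q R γ P) x = qf (openLoop A Q γ P) x - gainCost A B R γ P x := by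
  rw [riccatiOp, qf_matrix_sub, qf_conj, gainCost]

lemma qf_openLoop_sub_riccatiOp (x : Fin n → ℝ) :
    qf (openLoop A Q γ P - riccatiOp A B Q R γ P) x = gainCost A B R γ P x := by
  rw [qf_matrix_sub, qf_riccatiOp, sub_sub_cancel]

lemma IsAdmissible.isSymm (hP : IsAdmissible γ P) : P.IsSymm :=
  isSymm_of_posSemidef hP.1

lemma IsAdmissible.of_le (hP : IsAdmissible γ P) (hP' : P'.PosSemidef)
    (hle : ∀ x, qf P' x ≤ qf P x) : IsAdmissible γ P' := by
  refine ⟨hP', posDef_of_qf_pos (isSymm_gapMatrix (isSymm_of_posSemidef hP')) fun x hx => ?_⟩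
  have hpos := qf_pos hP.2 hx
  rw [qf_gapMatrix] at hpos ⊢
  linarith [hle x]

lemma dotProduct_sub_self (p v : Fin n → ℝ) :
    (p - v) ⬝ᵥ (p - v) = p ⬝ᵥ p - 2 * (p ⬝ᵥ v) + v ⬝ᵥ v := by
  simpa only [qf, one_mulVec] using qf_sub isSymm_one p v

lemma complete_square_disturbance (hP : IsAdmissible γ P) (p v : Fin n → ℝ) :
    qf P v - γ ^ 2 * ((p - v) ⬝ᵥ (p - v)) = qf (worstMatrix γ P) p
      - qf (gapMatrix γ P) (v - γ ^ 2 • ((gapMatrix γ P)⁻¹ *ᵥ p)) := by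
  rw [qf_sub (isSymm_gapMatrix hP.isSymm), mulVec_smul, mulVec_inv_mulVec hP.2.isUnit, qf_smul,
    qf_inv_mulVec hP.2, qf_worstMatrix, qf_gapMatrix, dotProduct_sub_self, dotProduct_smul,
    dotProduct_comm v p, smul_eq_mul]
  ring

lemma isGreatest_qf_worstMatrix (hP : IsAdmissible γ P) (p : Fin n → ℝ) :
    IsGreatest (Set.range fun v => qf P v - γ ^ 2 * ((p - v) ⬝ᵥ (p - v)))
      (qf (worstMatrix γ P) p) := by
  constructor
  · refine ⟨γ ^ 2 • ((gapMatrix γ P)⁻¹ *ᵥ p), ?_⟩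
    simp only [complete_square_disturbance hP, sub_self, qf_zero, sub_zero]
  · rintro _ ⟨v, rfl⟩
    simp only [complete_square_disturbance hP]
    exact sub_le_self _ (qf_nonneg hP.2.posSemidef _)

lemma qf_worstMatrix_mono (hP : IsAdmissible γ P) (hP' : IsAdmissible γ P')
    (hle : ∀ x, qf P x ≤ qf P' x) (p : Fin n → ℝ) :
    qf (worstMatrix γ P) p ≤ qf (worstMatrix γ P') p := by
  obtain ⟨v, hv⟩ := (isGreatest_qf_worstMatrix hP p).1
  have hv' := (isGreatest_qf_worstMatrix hP' p).2 ⟨v, rfl⟩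
  dsimp only at hv hv'
  linarith [hle v]

lemma IsAdmissible.posSemidef_worstMatrix (hP : IsAdmissible γ P) :
    (worstMatrix γ P).PosSemidef := by
  refine posSemidef_of_qf_nonneg (isSymm_worstMatrix hP.isSymm) fun p => ?_
  have hp := (isGreatest_qf_worstMatrix hP p).2 ⟨p, rfl⟩
  dsimp only at hp
  rw [sub_self, zero_dotProduct, mul_zero, sub_zero] at hp
  exact (qf_nonneg hP.1 p).trans hp

lemma IsAdmissible.posDef_inputMatrix (hP : IsAdmissible γ P) (hR : R.PosDef) :
    (inputMatrix B R γ P).PosDef := by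
  have hBMB := hP.posSemidef_worstMatrix.conjTranspose_mul_mul_same B
  rw [conjTranspose_eq_transpose_of_trivial] at hBMB
  exact hR.add_posSemidef hBMB

lemma gainCost_nonneg (hP : IsAdmissible γ P) (hR : R.PosDef) (x : Fin n → ℝ) :
    0 ≤ gainCost A B R γ P x :=
  qf_nonneg (hP.posDef_inputMatrix B hR).posSemidef _

lemma inputMatrix_mulVec_gain (hP : IsAdmissible γ P) (hR : R.PosDef) (x : Fin n → ℝ) :
    inputMatrix B R γ P *ᵥ (gain A B R γ P *ᵥ x)
      = Bᵀ *ᵥ (worstMatrix γ P *ᵥ (A *ᵥ x)) := by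
  rw [gain, ← mulVec_mulVec, mulVec_inv_mulVec (hP.posDef_inputMatrix B hR).isUnit]
  simp only [mulVec_mulVec, Matrix.mul_assoc]

lemma complete_square_input (hP : IsAdmissible γ P) (hR : R.PosDef) (x : Fin n → ℝ)
    (u : Fin m → ℝ) :
    qf Q x + qf R u + qf (worstMatrix γ P) (A *ᵥ x + B *ᵥ u)
      = qf (riccatiOp A B Q R γ P) x
        + qf (inputMatrix B R γ P) (u + gain A B R γ P *ᵥ x) := by
  rw [qf_add (isSymm_of_posDef (hP.posDef_inputMatrix B hR)),
    qf_add (isSymm_worstMatrix hP.isSymm), inputMatrix_mulVec_gain A B hP hR,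
    dotProduct_transpose_mulVec, qf_riccatiOp, gainCost, qf_openLoop, qf_inputMatrix B u,
    dotProduct_comm _ (B *ᵥ u), dotProduct_mulVec_comm (isSymm_worstMatrix hP.isSymm) (A *ᵥ x)]
  ring

lemma qf_riccatiOp_le (hP : IsAdmissible γ P) (hR : R.PosDef) (x : Fin n → ℝ)
    (u : Fin m → ℝ) :
    qf (riccatiOp A B Q R γ P) x
      ≤ qf Q x + qf R u + qf (worstMatrix γ P) (A *ᵥ x + B *ᵥ u) := by
  rw [complete_square_input A B Q hP hR]
  exact le_add_of_nonneg_right (qf_nonneg (hP.posDef_inputMatrix B hR).posSemidef _)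

lemma qf_riccatiOp_eq (hP : IsAdmissible γ P) (hR : R.PosDef) (x : Fin n → ℝ) :
    qf (riccatiOp A B Q R γ P) x = qf Q x + qf R (-(gain A B R γ P *ᵥ x))
      + qf (worstMatrix γ P) (A *ᵥ x + B *ᵥ (-(gain A B R γ P *ᵥ x))) := by
  rw [complete_square_input A B Q hP hR, neg_add_cancel, qf_zero, add_zero]

lemma riccatiMax_eq (hP : IsAdmissible γ P) (x : Fin n → ℝ) (u : Fin m → ℝ) :
    riccatiMax A B Q R γ P x u
      = ((qf Q x + qf R u + qf (worstMatrix γ P) (A *ᵥ x + B *ᵥ u) : ℝ) : EReal) := by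
  obtain ⟨⟨v, hv⟩, hmax⟩ := isGreatest_qf_worstMatrix hP (A *ᵥ x + B *ᵥ u)
  apply le_antisymm
  · refine iSup_le fun v => EReal.coe_le_coe_iff.2 ?_
    have := hmax ⟨v, rfl⟩
    dsimp only at this
    linarith
  · refine le_iSup_of_le v (EReal.coe_le_coe_iff.2 ?_)
    dsimp only at hv
    linarith

lemma iInf_riccatiMax (hP : IsAdmissible γ P) (hR : R.PosDef) (x : Fin n → ℝ) :
    ⨅ u, riccatiMax A B Q R γ P x u = ((qf (riccatiOp A B Q R γ P) x : ℝ) : EReal) := by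
  simp only [riccatiMax_eq A B Q hP]
  apply le_antisymm
  · rw [qf_riccatiOp_eq A B Q hP hR]
    exact iInf_le _ _
  · exact le_iInf fun u => EReal.coe_le_coe_iff.2 (qf_riccatiOp_le A B Q hP hR x u)

lemma IsAdmissible.qf_le_qf_riccatiOp (hP : IsAdmissible γ P) (hR : R.PosDef)
    (x : Fin n → ℝ) : qf Q x ≤ qf (riccatiOp A B Q R γ P) x := by
  rw [qf_riccatiOp_eq A B Q hP hR, add_assoc]
  exact le_add_of_nonneg_right
    (add_nonneg (qf_nonneg hR.posSemidef _) (qf_nonneg hP.posSemidef_worstMatrix _))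

lemma IsAdmissible.posSemidef_riccatiOp {Q : Matrix (Fin n) (Fin n) ℝ} (hP : IsAdmissible γ P)
    (hQ : Q.PosSemidef) (hR : R.PosDef) : (riccatiOp A B Q R γ P).PosSemidef :=
  posSemidef_of_qf_nonneg
    (isSymm_riccatiOp A B (isSymm_of_posSemidef hQ) (isSymm_of_posDef hR) hP.isSymm)
    fun x => (qf_nonneg hQ x).trans (hP.qf_le_qf_riccatiOp A B Q hR x)

lemma qf_riccatiOp_mono (hP : IsAdmissible γ P) (hP' : IsAdmissible γ P') (hR : R.PosDef)
    (hle : ∀ x, qf P x ≤ qf P' x) (x : Fin n → ℝ) :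
    qf (riccatiOp A B Q R γ P) x ≤ qf (riccatiOp A B Q R γ P') x := by
  rw [qf_riccatiOp_eq A B Q hP' hR]
  exact (qf_riccatiOp_le A B Q hP hR x _).trans
    (add_le_add_right (qf_worstMatrix_mono hP hP' hle _) _)

variable {A B Q}

lemma IsRiccatiSolution.isAdmissible (h : IsRiccatiSolution A B Q R γ P) : IsAdmissible γ P :=
  ⟨h.1.posSemidef, h.2.1⟩

lemma IsRiccatiSolution.riccatiOp_eq (h : IsRiccatiSolution A B Q R γ P) (hQ : Q.IsSymm)
    (hR : R.PosDef) : riccatiOp A B Q R γ P = P := by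
  refine eq_of_qf_eq (isSymm_riccatiOp A B hQ (isSymm_of_posDef hR) h.isAdmissible.isSymm)
    h.isAdmissible.isSymm fun x => ?_
  have hx := h.2.2 x
  rw [iInf_riccatiMax A B Q h.isAdmissible hR, EReal.coe_eq_coe_iff] at hx
  exact hx.symm

lemma isRiccatiSolution_of_riccatiOp_eq (hP : IsAdmissible γ P) (hQ : Q.PosDef) (hR : R.PosDef)
    (hfix : riccatiOp A B Q R γ P = P) : IsRiccatiSolution A B Q R γ P := by
  refine ⟨posDef_of_qf_pos hP.isSymm fun x hx => (qf_pos hQ hx).trans_le ?_, hP.2, fun x => ?_⟩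
  · simpa only [hfix] using hP.qf_le_qf_riccatiOp A B Q hR x
  · rw [iInf_riccatiMax A B Q hP hR, hfix]

lemma IsRiccatiGain.eq_gain {K : Matrix (Fin m) (Fin n) ℝ} (h : IsRiccatiGain A B Q R γ P K)
    (hP : IsAdmissible γ P) (hR : R.PosDef) : K = gain A B R γ P := by
  refine ext_of_mulVec_single fun i => ?_
  generalize (Pi.single i 1 : Fin n → ℝ) = x
  have hle := h x (-(gain A B R γ P *ᵥ x))
  simp only [riccatiMax_eq A B Q hP, EReal.coe_le_coe_iff, complete_square_input A B Q hP hR,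
    neg_add_cancel, qf_zero] at hle
  by_contra hne
  have hne' : -(K *ᵥ x) + gain A B R γ P *ᵥ x ≠ 0 := fun h0 => hne (neg_add_eq_zero.1 h0)
  linarith [qf_pos (hP.posDef_inputMatrix B hR) hne']

lemma mul_inv_gapMatrix (hG : IsUnit (gapMatrix γ P)) :
    P * (gapMatrix γ P)⁻¹ = γ ^ 2 • (gapMatrix γ P)⁻¹ - 1 := by
  have hdet := (isUnit_iff_isUnit_det _).1 hG
  calc P * (gapMatrix γ P)⁻¹
      = (γ ^ 2 • (1 : Matrix (Fin n) (Fin n) ℝ) - gapMatrix γ P) * (gapMatrix γ P)⁻¹ := by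
        rw [gapMatrix, sub_sub_cancel]
    _ = γ ^ 2 • (gapMatrix γ P)⁻¹ - 1 := by
        rw [Matrix.sub_mul, mul_nonsing_inv _ hdet, Matrix.smul_mul, Matrix.one_mul]

lemma inv_sub_mul_worstMatrix (hγ : γ ≠ 0) (hP : IsUnit P) (hG : IsUnit (gapMatrix γ P)) :
    (P⁻¹ - (γ ^ 2)⁻¹ • (1 : Matrix (Fin n) (Fin n) ℝ)) * worstMatrix γ P = 1 := by
  have hworst : worstMatrix γ P = γ ^ 2 • (P * (gapMatrix γ P)⁻¹) := by
    rw [mul_inv_gapMatrix hG, worstMatrix, smul_sub, smul_smul, sq (γ ^ 2)]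
  have hfactor : γ ^ 2 • ((P⁻¹ - (γ ^ 2)⁻¹ • (1 : Matrix (Fin n) (Fin n) ℝ)) * P)
      = gapMatrix γ P := by
    rw [Matrix.sub_mul, nonsing_inv_mul _ ((isUnit_iff_isUnit_det _).1 hP), smul_sub,
      Matrix.smul_mul, Matrix.one_mul, smul_smul, mul_inv_cancel₀ (pow_ne_zero 2 hγ), one_smul,
      gapMatrix]
  rw [hworst, Matrix.mul_smul, ← Matrix.mul_assoc, ← Matrix.smul_mul, hfactor,
    mul_nonsing_inv _ ((isUnit_iff_isUnit_det _).1 hG)]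

variable (A Q) in
lemma Tmat_eq_openLoop (hγ : γ ≠ 0) (hP : IsUnit P) (hG : IsUnit (gapMatrix γ P)) :
    Tmat A Q γ P = openLoop A Q γ P := by
  rw [Tmat, openLoop, inv_eq_right_inv (inv_sub_mul_worstMatrix hγ hP hG)]

end Riccati

/-! ### The scalar maximization over mixtures of the two signs -/

/-- The maximum of `(1 - σ²) d + 2 σ y` over `|σ| ≤ 1`, where `σ` is the mean of a random sign:
`d` is the gain from concealing the sign and `y` the gain from revealing it. -/
def satValue (d y : ℝ) : ℝ := if d ≤ |y| then 2 * |y| else d + y ^ 2 / d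

lemma satValue_zero_right {d : ℝ} (hd : 0 ≤ d) : satValue d 0 = d := by
  unfold satValue
  split_ifs with h
  · rw [abs_zero] at h ⊢
    linarith
  · simp

lemma le_satValue {d y σ : ℝ} (hσ : |σ| ≤ 1) :
    (1 - σ ^ 2) * d + 2 * σ * y ≤ satValue d y := by
  unfold satValue
  split_ifs with hy
  · have hσy : σ * y ≤ |σ| * |y| := (le_abs_self _).trans_eq (abs_mul σ y)
    have hdy : (1 - σ ^ 2) * d ≤ (1 - σ ^ 2) * |y| :=
      mul_le_mul_of_nonneg_left hy (sub_nonneg.2 ((sq_le_one_iff_abs_le_one σ).2 hσ))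
    have hsq : 0 ≤ (1 - |σ|) ^ 2 * |y| := by positivity
    linarith [sq_abs σ, congrArg (· * |y|) (sq_abs σ)]
  · have hd' : 0 < d := (abs_nonneg y).trans_lt (not_le.1 hy)
    have hsq : (y - σ * d) ^ 2 / d = y ^ 2 / d - 2 * σ * y + σ ^ 2 * d := by field_simp; ring
    have hnonneg : 0 ≤ (y - σ * d) ^ 2 / d := by positivity
    linarith

lemma exists_sign_mul_eq_abs (y : ℝ) : ∃ i : ℝ, (i = 1 ∨ i = -1) ∧ i * y = |y| := by
  rcases abs_choice y with h | h
  · exact ⟨1, Or.inl rfl, by rw [h, one_mul]⟩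
  · exact ⟨-1, Or.inr rfl, by rw [h, neg_one_mul]⟩

lemma abs_eq_one_of_sign {i : ℝ} (hi : i = 1 ∨ i = -1) : |i| = 1 := by
  rcases hi with rfl | rfl <;> simp

lemma exists_eq_satValue (d y : ℝ) :
    ∃ σ : ℝ, |σ| ≤ 1 ∧ (1 - σ ^ 2) * d + 2 * σ * y = satValue d y := by
  unfold satValue
  split_ifs with hy
  · obtain ⟨i, hi, hiy⟩ := exists_sign_mul_eq_abs y
    refine ⟨i, (abs_eq_one_of_sign hi).le, ?_⟩
    rw [sq_eq_one_iff.2 hi, mul_assoc, hiy, sub_self, zero_mul, zero_add]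
  · have hyd : |y| < d := not_le.1 hy
    have hd : 0 < d := (abs_nonneg y).trans_lt hyd
    refine ⟨y / d, ?_, by field_simp; ring⟩
    rw [abs_div, abs_of_pos hd]
    exact (div_le_one₀ hd).2 hyd.le

lemma abs_sat_le_one (y : ℝ) : |sat y| ≤ 1 := by
  unfold sat
  split_ifs with h1 h2
  · simp
  · simp
  · exact abs_le.2 ⟨not_lt.1 h2, not_lt.1 h1⟩

lemma satValue_eq_sat {d : ℝ} (hd : 0 ≤ d) (y : ℝ) :
    satValue d y = d + sat (y / d) ^ 2 * d + 2 * |y - sat (y / d) * d| := by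
  rcases hd.eq_or_lt with rfl | hd
  · simp [satValue]
  have hdiv : y / d * d = y := div_mul_cancel₀ y hd.ne'
  unfold satValue sat
  simp only [one_lt_div hd, div_lt_iff₀ hd, neg_one_mul]
  split_ifs with hy h1 h2 h1 h2
  · rw [abs_of_pos (hd.trans h1), abs_of_pos (by linarith)]
    ring
  · rw [abs_of_neg (by linarith), abs_of_neg (by linarith)]
    ring
  · have habs : |y| = d := le_antisymm (abs_le.2 ⟨not_lt.1 h2, not_lt.1 h1⟩) hy
    rw [hdiv, sub_self, abs_zero, div_pow, ← sq_abs y, habs]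
    field_simp
    ring
  · exact absurd (h1.le.trans (le_abs_self y)) hy
  · exact absurd (le_abs.2 (Or.inr (by linarith))) hy
  · rw [hdiv, sub_self, abs_zero]
    field_simp
    ring

/-! ### The matrix inequality -/

section MatrixInequality

variable {k : ℕ} {G D F W : Matrix (Fin k) (Fin k) ℝ}

lemma inv_mulVec_mulVec_dotProduct (hG : G.PosDef) (z ζ : Fin k → ℝ) :
    (G⁻¹ *ᵥ (W *ᵥ z)) ⬝ᵥ (G *ᵥ ζ) = z ⬝ᵥ (Wᵀ *ᵥ ζ) := by
  rw [dotProduct_mulVec_comm (isSymm_of_posDef hG), mulVec_inv_mulVec hG.isUnit,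
    dotProduct_transpose_mulVec]

lemma forall_mul_qf_sub_le_iff (hG : G.PosDef) (hD : D.PosDef) {τ : ℝ} (hτ : 0 < τ) :
    (∀ z v, τ * (qf D v - qf G⁻¹ z) ≤ qf G (v - G⁻¹ *ᵥ (W *ᵥ z))) ↔
      ∀ ζ, τ * qf G ζ + qf G (Wᵀ *ᵥ ζ) ≤ qf D⁻¹ (G *ᵥ ζ) := by
  constructor
  · intro h ζ
    set c := τ * qf G ζ + qf G (Wᵀ *ᵥ ζ)
    set z := G *ᵥ (Wᵀ *ᵥ ζ) with hz
    set v := G⁻¹ *ᵥ (W *ᵥ z) + τ • ζ with hv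
    have hcross : v ⬝ᵥ (G *ᵥ ζ) = c := by
      rw [hv, add_dotProduct, inv_mulVec_mulVec_dotProduct hG, smul_dotProduct, smul_eq_mul, hz,
        dotProduct_comm, add_comm]
      rfl
    have hprimal := h z v
    rw [hv, add_sub_cancel_left, qf_smul, sq, mul_assoc, ← hv,
      ← qf_inv_mulVec hG, hz, inv_mulVec_mulVec hG.isUnit] at hprimal
    have hvc : qf D v ≤ c := by linarith [le_of_mul_le_mul_left hprimal hτ]
    have hyoung := two_mul_dotProduct_le hD v (G *ᵥ ζ)
    rw [hcross] at hyoung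
    linarith
  · intro h z v
    set p := G⁻¹ *ᵥ (W *ᵥ z) with hp
    set ζ := G⁻¹ *ᵥ (D *ᵥ v)
    have hGζ : G *ᵥ ζ = D *ᵥ v := mulVec_inv_mulVec hG.isUnit _
    have hdual := h ζ
    rw [hGζ, ← qf_inv_mulVec hD, inv_mulVec_mulVec hD.isUnit] at hdual
    have hsplit : qf D v = (v - p) ⬝ᵥ (G *ᵥ ζ) + (Wᵀ *ᵥ ζ) ⬝ᵥ z := by
      rw [sub_dotProduct, hp, inv_mulVec_mulVec_dotProduct hG, dotProduct_comm z, hGζ,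
        sub_add_cancel, qf]
    have hyoung₁ := two_mul_dotProduct_mulVec_le hG.posSemidef (v - p) (τ • ζ)
    rw [mulVec_smul, dotProduct_smul, qf_smul, smul_eq_mul] at hyoung₁
    have hyoung₂ := two_mul_dotProduct_le hG (Wᵀ *ᵥ ζ) z
    linarith [mul_le_mul_of_nonneg_left hyoung₂ hτ.le, mul_le_mul_of_nonneg_left hdual hτ.le,
      congrArg (τ * ·) hsplit]

lemma posSemidef_sub_conj_iff (hG : G.IsSymm) (hD : D.IsSymm) :
    (G * D * G - W * G * Wᵀ).PosSemidef ↔ ∀ ζ, qf G (Wᵀ *ᵥ ζ) ≤ qf D (G *ᵥ ζ) := by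
  have hGDG := isSymm_conj hD G
  have hWGW := isSymm_conj hG Wᵀ
  have hqf : ∀ ζ, qf (G * D * G - W * G * Wᵀ) ζ = qf D (G *ᵥ ζ) - qf G (Wᵀ *ᵥ ζ) := fun ζ => by
    rw [qf_matrix_sub, ← qf_conj, ← qf_conj, hG.eq, transpose_transpose]
  rw [hG.eq] at hGDG
  rw [transpose_transpose] at hWGW
  constructor
  · intro h ζ
    have hζ := qf_nonneg h ζ
    rwa [hqf, sub_nonneg] at hζ
  · exact fun h => posSemidef_of_qf_nonneg (hGDG.sub hWGW) fun ζ => by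
      rw [hqf, sub_nonneg]
      exact h ζ

/-- The pointwise form of the matrix inequality, for the input `θ` times the Riccati gain and a
random sign of mean `σ`; `z` stands for `γ² A x` and `F z` for `γ² B K x`. -/
def MixtureBound (G D F : Matrix (Fin k) (Fin k) ℝ) (θ σ : ℝ) : Prop :=
  ∀ z v, (1 - σ ^ 2) * (qf D v - qf G⁻¹ z) ≤ qf G (v - G⁻¹ *ᵥ ((θ • F - σ • 1) *ᵥ z))

lemma qf_transpose_smul_sub_smul_one (hG : G.IsSymm) (θ σ : ℝ) (ζ : Fin k → ℝ) :
    qf G ((θ • F - σ • 1)ᵀ *ᵥ ζ)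
      = θ ^ 2 * qf G (Fᵀ *ᵥ ζ) - 2 * (θ * σ) * (ζ ⬝ᵥ (G *ᵥ (Fᵀ *ᵥ ζ))) + σ ^ 2 * qf G ζ := by
  rw [transpose_sub, transpose_smul, transpose_smul, transpose_one, sub_mulVec, smul_mulVec,
    smul_mulVec, one_mulVec, qf_sub hG, qf_smul, qf_smul, mulVec_smul, smul_dotProduct,
    dotProduct_smul, dotProduct_mulVec_comm hG, smul_eq_mul, smul_eq_mul]
  ring

lemma mixtureBound_iff (hG : G.PosDef) (hD : D.PosDef) {θ σ : ℝ} (hσ : |σ| < 1) :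
    MixtureBound G D F θ σ ↔ ∀ ζ, qf G ζ + θ ^ 2 * qf G (Fᵀ *ᵥ ζ)
      - 2 * (θ * σ) * (ζ ⬝ᵥ (G *ᵥ (Fᵀ *ᵥ ζ))) ≤ qf D⁻¹ (G *ᵥ ζ) := by
  rw [MixtureBound, forall_mul_qf_sub_le_iff hG hD (sub_pos.2 ((sq_lt_one_iff_abs_lt_one σ).2 hσ))]
  refine forall_congr' fun ζ => ?_
  rw [qf_transpose_smul_sub_smul_one (isSymm_of_posDef hG)]
  ring_nf

lemma mixtureBound_of_abs_eq_one (hG : G.PosSemidef) {θ σ : ℝ} (hσ : |σ| = 1) :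
    MixtureBound G D F θ σ := fun z v => by
  rw [← sq_abs, hσ, one_pow, sub_self, zero_mul]
  exact qf_nonneg hG _

lemma posSemidef_sub_one_add_smul_conj_iff (hG : G.PosDef) (hD : D.PosDef) {ε : ℝ}
    (hε : ε = 1 ∨ ε = -1) :
    (G * D⁻¹ * G - (1 + ε • F) * G * (1 + ε • F)ᵀ).PosSemidef ↔
      ∀ ζ, qf G ζ + qf G (Fᵀ *ᵥ ζ) + 2 * ε * (ζ ⬝ᵥ (G *ᵥ (Fᵀ *ᵥ ζ))) ≤ qf D⁻¹ (G *ᵥ ζ) := by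
  rw [posSemidef_sub_conj_iff (isSymm_of_posDef hG) (isSymm_of_posDef hD).inv]
  refine forall_congr' fun ζ => ?_
  have hW : (1 : Matrix (Fin k) (Fin k) ℝ) + ε • F = ε • F - (-1 : ℝ) • 1 := by
    rw [neg_one_smul, sub_neg_eq_add, add_comm]
  rw [hW, qf_transpose_smul_sub_smul_one (isSymm_of_posDef hG),
    sq_eq_one_iff.2 hε]
  ring_nf

lemma mixtureBound_of_posSemidef (hG : G.PosDef) (hD : D.PosDef)
    (h : ∀ ε : ℝ, ε = 1 ∨ ε = -1 →
      (G * D⁻¹ * G - (1 + ε • F) * G * (1 + ε • F)ᵀ).PosSemidef)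
    {θ σ : ℝ} (hθ : |θ| ≤ 1) (hσ : |σ| ≤ 1) : MixtureBound G D F θ σ := by
  rcases hσ.eq_or_lt with hσ | hσ
  · exact mixtureBound_of_abs_eq_one hG.posSemidef hσ
  refine (mixtureBound_iff hG hD hσ).2 fun ζ => ?_
  set s := ζ ⬝ᵥ (G *ᵥ (Fᵀ *ᵥ ζ))
  obtain ⟨ε, hε, hεs⟩ := exists_sign_mul_eq_abs s
  have hbound := (posSemidef_sub_one_add_smul_conj_iff hG hD hε).1 (h ε hε) ζ
  have hθsq : θ ^ 2 * qf G (Fᵀ *ᵥ ζ) ≤ qf G (Fᵀ *ᵥ ζ) :=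
    mul_le_of_le_one_left (qf_nonneg hG.posSemidef _) ((sq_le_one_iff_abs_le_one θ).2 hθ)
  have hθσ : -(θ * σ * s) ≤ |s| := by
    refine (neg_le_abs _).trans ?_
    rw [abs_mul, abs_mul]
    exact mul_le_of_le_one_left (abs_nonneg s) (mul_le_one₀ hθ (abs_nonneg σ) hσ.le)
  linarith

lemma posSemidef_of_mixtureBound (hG : G.PosDef) (hD : D.PosDef)
    (h : ∀ σ : ℝ, |σ| < 1 → MixtureBound G D F 1 σ) {ε : ℝ} (hε : ε = 1 ∨ ε = -1) :
    (G * D⁻¹ * G - (1 + ε • F) * G * (1 + ε • F)ᵀ).PosSemidef := by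
  refine (posSemidef_sub_one_add_smul_conj_iff hG hD hε).2 fun ζ => ?_
  have hclosed : IsClosed {σ : ℝ | qf G ζ + qf G (Fᵀ *ᵥ ζ) - 2 * σ * (ζ ⬝ᵥ (G *ᵥ (Fᵀ *ᵥ ζ)))
      ≤ qf D⁻¹ (G *ᵥ ζ)} :=
    isClosed_le (by fun_prop) continuous_const
  have hIoo : Set.Ioo (-1 : ℝ) 1 ⊆
      {σ : ℝ | qf G ζ + qf G (Fᵀ *ᵥ ζ) - 2 * σ * (ζ ⬝ᵥ (G *ᵥ (Fᵀ *ᵥ ζ)))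
      ≤ qf D⁻¹ (G *ᵥ ζ)} := fun σ hσ => by
    have hbound := (mixtureBound_iff hG hD (abs_lt.2 hσ)).1 (h σ (abs_lt.2 hσ)) ζ
    rwa [one_pow, one_mul, one_mul] at hbound
  have hIcc := hclosed.closure_subset_iff.2 hIoo
  rw [closure_Ioo (by norm_num)] at hIcc
  have hmem : -ε ∈ Set.Icc (-1 : ℝ) 1 := abs_le.1 (by rw [abs_neg, abs_eq_one_of_sign hε])
  have hlim : qf G ζ + qf G (Fᵀ *ᵥ ζ) - 2 * -ε * (ζ ⬝ᵥ (G *ᵥ (Fᵀ *ᵥ ζ)))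
      ≤ qf D⁻¹ (G *ᵥ ζ) := hIcc hmem
  linarith

end MatrixInequality

/-! ### One step of the game -/

/-- The part of the stage cost that does not depend on the sign, when the next state is `v`. -/
def stage (A : Matrix (Fin n) (Fin n) ℝ) (B : Matrix (Fin n) (Fin m) ℝ)
    (Q : Matrix (Fin n) (Fin n) ℝ) (R : Matrix (Fin m) (Fin m) ℝ) (γ : ℝ)
    (x : Fin n → ℝ) (u : Fin m → ℝ) (v : Fin n → ℝ) : ℝ :=
  qf Q x + qf R u - γ ^ 2 * ((B *ᵥ u - v) ⬝ᵥ (B *ᵥ u - v)) - γ ^ 2 * ((A *ᵥ x) ⬝ᵥ (A *ᵥ x))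

/-- The increment of `y = ⟨A, Y⟩` in one step. -/
def corr (A : Matrix (Fin n) (Fin n) ℝ) (B : Matrix (Fin n) (Fin m) ℝ) (γ : ℝ)
    (x : Fin n → ℝ) (u : Fin m → ℝ) (v : Fin n → ℝ) : ℝ :=
  γ ^ 2 * ((B *ᵥ u - v) ⬝ᵥ (A *ᵥ x))

/-- The stage cost averaged over a random plant sign `-i` with `i` of mean `σ`. For `σ = ±1` it is
the stage cost of the plant sign `-σ`. -/
def mixedStage (A : Matrix (Fin n) (Fin n) ℝ) (B : Matrix (Fin n) (Fin m) ℝ)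
    (Q : Matrix (Fin n) (Fin n) ℝ) (R : Matrix (Fin m) (Fin m) ℝ) (γ σ : ℝ)
    (x : Fin n → ℝ) (u : Fin m → ℝ) (v : Fin n → ℝ) : ℝ :=
  stage A B Q R γ x u v + 2 * σ * corr A B γ x u v

/-- The value in the state `x` with data `y = ⟨A, Y⟩` if the sign is revealed and `P` is the cost
matrix of the game with known sign; a term depending on the data alone is left out. -/
def revealed (P : Matrix (Fin n) (Fin n) ℝ) (x : Fin n → ℝ) (y : ℝ) : ℝ :=
  qf P x + 2 * |y|

/-- The value if the sign is concealed for one more step and `revealed P` is the value thereafter.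
For a solution `P` of the Riccati equation this is the value function of the paper. -/
def concealed (A : Matrix (Fin n) (Fin n) ℝ) (B : Matrix (Fin n) (Fin m) ℝ)
    (Q : Matrix (Fin n) (Fin n) ℝ) (R : Matrix (Fin m) (Fin m) ℝ) (γ : ℝ)
    (P : Matrix (Fin n) (Fin n) ℝ) (x : Fin n → ℝ) (y : ℝ) : ℝ :=
  qf (riccatiOp A B Q R γ P) x + satValue (gainCost A B R γ P x) y

/-- The input `sat (y / |K x|²_S) K x` of the saturated control law. -/
def satInput (A : Matrix (Fin n) (Fin n) ℝ) (B : Matrix (Fin n) (Fin m) ℝ)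
    (R : Matrix (Fin m) (Fin m) ℝ) (γ : ℝ) (P : Matrix (Fin n) (Fin n) ℝ)
    (x : Fin n → ℝ) (y : ℝ) : Fin m → ℝ :=
  sat (y / gainCost A B R γ P x) • (gain A B R γ P *ᵥ x)

/-- Under the saturated input the value `concealed P` does not increase, whatever the next state. -/
def IsSupersolution (A : Matrix (Fin n) (Fin n) ℝ) (B : Matrix (Fin n) (Fin m) ℝ)
    (Q : Matrix (Fin n) (Fin n) ℝ) (R : Matrix (Fin m) (Fin m) ℝ) (γ : ℝ)
    (P : Matrix (Fin n) (Fin n) ℝ) : Prop :=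
  ∀ x v y, stage A B Q R γ x (satInput A B R γ P x y) v
    + concealed A B Q R γ P v (y + corr A B γ x (satInput A B R γ P x y) v)
      ≤ concealed A B Q R γ P x y

section OneStep

variable (A : Matrix (Fin n) (Fin n) ℝ) (B : Matrix (Fin n) (Fin m) ℝ)
  (Q : Matrix (Fin n) (Fin n) ℝ) {R : Matrix (Fin m) (Fin m) ℝ} {γ : ℝ}
  {P : Matrix (Fin n) (Fin n) ℝ}

lemma mixedStage_eq (σ : ℝ) (x : Fin n → ℝ) (u : Fin m → ℝ) (v : Fin n → ℝ) :
    mixedStage A B Q R γ σ x u v = qf Q x + qf R u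
      - γ ^ 2 * ((B *ᵥ u - σ • (A *ᵥ x) - v) ⬝ᵥ (B *ᵥ u - σ • (A *ᵥ x) - v))
      - γ ^ 2 * (1 - σ ^ 2) * ((A *ᵥ x) ⬝ᵥ (A *ᵥ x)) := by
  rw [sub_right_comm (B *ᵥ u), dotProduct_sub_self (B *ᵥ u - v), mixedStage, stage, corr]
  simp only [smul_dotProduct, dotProduct_smul, smul_eq_mul]
  ring

lemma mixedStage_add_qf (hP : IsAdmissible γ P) (σ : ℝ) (x : Fin n → ℝ) (u : Fin m → ℝ)
    (v : Fin n → ℝ) :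
    mixedStage A B Q R γ σ x u v + qf P v
      = qf Q x + qf R u + qf (worstMatrix γ P) (B *ᵥ u - σ • (A *ᵥ x))
        - γ ^ 2 * (1 - σ ^ 2) * ((A *ᵥ x) ⬝ᵥ (A *ᵥ x))
        - qf (gapMatrix γ P) (v - γ ^ 2 • ((gapMatrix γ P)⁻¹ *ᵥ (B *ᵥ u - σ • (A *ᵥ x)))) := by
  rw [mixedStage_eq]
  linarith [complete_square_disturbance hP (B *ᵥ u - σ • (A *ᵥ x)) v]

lemma exists_mixedStage_add_qf_eq (hP : IsAdmissible γ P) (hR : R.PosDef) (x : Fin n → ℝ)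
    (u : Fin m → ℝ) {i : ℝ} (hi : i = 1 ∨ i = -1) :
    ∃ v, mixedStage A B Q R γ i x u v + qf P v = qf (riccatiOp A B Q R γ P) x
      + qf (inputMatrix B R γ P) (u - i • (gain A B R γ P *ᵥ x)) := by
  refine ⟨γ ^ 2 • ((gapMatrix γ P)⁻¹ *ᵥ (B *ᵥ u - i • (A *ᵥ x))), ?_⟩
  have hsq : i ^ 2 = 1 := sq_eq_one_iff.2 hi
  have hsquare := complete_square_input A B Q hP hR (-(i • x)) u
  simp only [qf_neg, qf_smul, hsq, one_mul, mulVec_neg, mulVec_smul, neg_add_eq_sub,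
    ← sub_eq_add_neg] at hsquare
  rw [mixedStage_add_qf A B Q hP, hsq, sub_self, sub_self, qf_zero, hsquare]
  ring

lemma exists_sign_average_le (f : ℝ → ℝ) {σ : ℝ} (hσ : |σ| ≤ 1) :
    ∃ i : ℝ, (i = 1 ∨ i = -1) ∧ (1 + σ) / 2 * f 1 + (1 - σ) / 2 * f (-1) ≤ f i := by
  obtain ⟨hσ₁, hσ₂⟩ := abs_le.1 hσ
  rcases le_total (f (-1)) (f 1) with h | h
  · refine ⟨1, Or.inl rfl, ?_⟩
    linarith [mul_le_mul_of_nonneg_left h (show 0 ≤ (1 - σ) / 2 by linarith)]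
  · refine ⟨-1, Or.inr rfl, ?_⟩
    linarith [mul_le_mul_of_nonneg_left h (show 0 ≤ (1 + σ) / 2 by linarith)]

lemma sign_mul_le_abs {i : ℝ} (hi : i = 1 ∨ i = -1) (y : ℝ) : i * y ≤ |y| := by
  rw [← one_mul |y|, ← abs_eq_one_of_sign hi, ← abs_mul]
  exact le_abs_self _

lemma exists_le_stage_add_revealed (hP : IsAdmissible γ P) (hR : R.PosDef) (x : Fin n → ℝ)
    (u : Fin m → ℝ) (y : ℝ) {σ : ℝ} (hσ : |σ| ≤ 1) :
    ∃ v, qf (riccatiOp A B Q R γ P) x + ((1 - σ ^ 2) * gainCost A B R γ P x + 2 * σ * y)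
      ≤ stage A B Q R γ x u v + revealed P v (y + corr A B γ x u v) := by
  have hS := hP.posDef_inputMatrix B hR
  have hexpand : ∀ c : ℝ, qf (inputMatrix B R γ P) (u - c • (gain A B R γ P *ᵥ x))
      = qf (inputMatrix B R γ P) u
        - 2 * (c * (u ⬝ᵥ (inputMatrix B R γ P *ᵥ (gain A B R γ P *ᵥ x))))
        + c ^ 2 * gainCost A B R γ P x := fun c => by
    rw [qf_sub (isSymm_of_posDef hS), qf_smul, mulVec_smul, dotProduct_smul, smul_eq_mul, gainCost]
  obtain ⟨i, hi, havg⟩ := exists_sign_average_le (fun i => qf (riccatiOp A B Q R γ P) x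
    + qf (inputMatrix B R γ P) (u - i • (gain A B R γ P *ᵥ x)) + 2 * i * y) hσ
  obtain ⟨v, hv⟩ := exists_mixedStage_add_qf_eq A B Q hP hR x u hi
  refine ⟨v, ?_⟩
  have hσS := qf_nonneg hS.posSemidef (u - σ • (gain A B R γ P *ᵥ x))
  have habs := sign_mul_le_abs hi (y + corr A B γ x u v)
  rw [← hv, hexpand, hexpand, mixedStage] at havg
  rw [hexpand] at hσS
  rw [revealed]
  linarith

lemma exists_concealed_le (hP : IsAdmissible γ P) (hR : R.PosDef) (x : Fin n → ℝ)
    (u : Fin m → ℝ) (y : ℝ) :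
    ∃ v, concealed A B Q R γ P x y
      ≤ stage A B Q R γ x u v + revealed P v (y + corr A B γ x u v) := by
  obtain ⟨σ, hσ, hval⟩ := exists_eq_satValue (gainCost A B R γ P x) y
  rw [concealed, ← hval]
  exact exists_le_stage_add_revealed A B Q hP hR x u y hσ

lemma revealed_riccatiOp_le_concealed (x : Fin n → ℝ) (y : ℝ) :
    revealed (riccatiOp A B Q R γ P) x y ≤ concealed A B Q R γ P x y := by
  obtain ⟨i, hi, hiy⟩ := exists_sign_mul_eq_abs y
  have h := le_satValue (d := gainCost A B R γ P x) (y := y) (abs_eq_one_of_sign hi).le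
  rw [sq_eq_one_iff.2 hi, sub_self, zero_mul, zero_add, mul_assoc, hiy] at h
  exact add_le_add_right h _

lemma concealed_zero (hP : IsAdmissible γ P) (hR : R.PosDef) (x : Fin n → ℝ) :
    concealed A B Q R γ P x 0 = qf (openLoop A Q γ P) x := by
  rw [concealed, satValue_zero_right (gainCost_nonneg A B hP hR x), qf_riccatiOp, sub_add_cancel]

lemma mixedStage_smul_gain_add_qf (hP : IsAdmissible γ P) (hR : R.PosDef) (θ σ : ℝ)
    (x v : Fin n → ℝ) :
    mixedStage A B Q R γ σ x (θ • (gain A B R γ P *ᵥ x)) v + qf P v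
      = qf (openLoop A Q γ P) x + (θ ^ 2 - 2 * θ * σ) * gainCost A B R γ P x
        - (1 - σ ^ 2) * qf (gapMatrix γ P)⁻¹ (γ ^ 2 • (A *ᵥ x))
        - qf (gapMatrix γ P) (v - (gapMatrix γ P)⁻¹ *ᵥ
            (θ • (γ ^ 2 • (B *ᵥ (gain A B R γ P *ᵥ x))) - σ • (γ ^ 2 • (A *ᵥ x)))) := by
  set k := gain A B R γ P *ᵥ x with hk
  have hcross : (B *ᵥ k) ⬝ᵥ (worstMatrix γ P *ᵥ (A *ᵥ x)) = gainCost A B R γ P x := by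
    rw [gainCost, qf, inputMatrix_mulVec_gain A B hP hR, dotProduct_transpose_mulVec,
      dotProduct_comm, hk]
  have hp : (gapMatrix γ P)⁻¹ *ᵥ (θ • (γ ^ 2 • (B *ᵥ k)) - σ • (γ ^ 2 • (A *ᵥ x)))
      = γ ^ 2 • ((gapMatrix γ P)⁻¹ *ᵥ (B *ᵥ (θ • k) - σ • (A *ᵥ x))) := by
    simp only [← mulVec_smul (gapMatrix γ P)⁻¹, smul_sub, mulVec_smul B, smul_comm (γ ^ 2)]
  have hS : gainCost A B R γ P x = qf R k + qf (worstMatrix γ P) (B *ᵥ k) := qf_inputMatrix B k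
  have hM := qf_worstMatrix (γ := γ) (P := P) (A *ᵥ x)
  rw [hp, mixedStage_add_qf A B Q hP, qf_sub (isSymm_worstMatrix hP.isSymm), qf_openLoop]
  simp only [mulVec_smul, qf_smul, smul_dotProduct, dotProduct_smul, smul_eq_mul, hcross]
  linear_combination -θ ^ 2 * hS - (1 - σ ^ 2) * hM

lemma mixtureBound_iff_mixedStage_le {D : Matrix (Fin n) (Fin n) ℝ} (hP : IsAdmissible γ P)
    (hR : R.PosDef) (hA : IsUnit A) (hγ : γ ≠ 0) {θ σ : ℝ} :
    MixtureBound (gapMatrix γ P) D (B * gain A B R γ P * A⁻¹) θ σ ↔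
      ∀ x v, mixedStage A B Q R γ σ x (θ • (gain A B R γ P *ᵥ x)) v + qf P v
        + (1 - σ ^ 2) * qf D v
          ≤ qf (openLoop A Q γ P) x + (θ ^ 2 - 2 * θ * σ) * gainCost A B R γ P x := by
  have hz : Function.Surjective fun x : Fin n → ℝ => γ ^ 2 • (A *ᵥ x) := fun z =>
    ⟨A⁻¹ *ᵥ ((γ ^ 2)⁻¹ • z), by
      dsimp only
      rw [mulVec_inv_mulVec hA, smul_inv_smul₀ (pow_ne_zero 2 hγ)]⟩
  rw [MixtureBound, hz.forall]
  refine forall₂_congr fun x v => ?_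
  have hF : (B * gain A B R γ P * A⁻¹) *ᵥ (γ ^ 2 • (A *ᵥ x))
      = γ ^ 2 • (B *ᵥ (gain A B R γ P *ᵥ x)) := by
    rw [mulVec_smul, ← mulVec_mulVec, inv_mulVec_mulVec hA, mulVec_mulVec]
  rw [mixedStage_smul_gain_add_qf A B Q hP hR, sub_mulVec, smul_mulVec, smul_mulVec, hF,
    one_mulVec]
  constructor <;> intro h <;> linarith

variable {A B Q}

lemma stage_satInput_add_le (hP : IsAdmissible γ P) (hR : R.PosDef) {x v : Fin n → ℝ}
    {y σ c : ℝ} (hσ : |σ| ≤ 1)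
    (h : mixedStage A B Q R γ σ x (satInput A B R γ P x y) v + qf P v + c
      ≤ qf (openLoop A Q γ P) x + (sat (y / gainCost A B R γ P x) ^ 2
        - 2 * sat (y / gainCost A B R γ P x) * σ) * gainCost A B R γ P x) :
    stage A B Q R γ x (satInput A B R γ P x y) v
      + (qf P v + (c + 2 * σ * (y + corr A B γ x (satInput A B R γ P x y) v)))
        ≤ concealed A B Q R γ P x y := by
  set θ := sat (y / gainCost A B R γ P x)
  have hσy : σ * (y - θ * gainCost A B R γ P x) ≤ |y - θ * gainCost A B R γ P x| := by
    refine (le_abs_self _).trans ?_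
    rw [abs_mul]
    exact mul_le_of_le_one_left (abs_nonneg _) hσ
  rw [mixedStage] at h
  rw [concealed, satValue_eq_sat (gainCost_nonneg A B hP hR x), qf_riccatiOp]
  linarith

lemma stage_satInput_add_revealed_le (hP : IsAdmissible γ P) (hR : R.PosDef) (x v : Fin n → ℝ)
    (y : ℝ) :
    stage A B Q R γ x (satInput A B R γ P x y) v
      + revealed P v (y + corr A B γ x (satInput A B R γ P x y) v)
        ≤ concealed A B Q R γ P x y := by
  obtain ⟨i, hi, hiy⟩ :=
    exists_sign_mul_eq_abs (y + corr A B γ x (satInput A B R γ P x y) v)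
  have h := stage_satInput_add_le hP hR (x := x) (v := v) (y := y) (c := 0)
    (abs_eq_one_of_sign hi).le (by
      rw [satInput, mixedStage_smul_gain_add_qf A B Q hP hR, sq_eq_one_iff.2 hi, sub_self, zero_mul,
        sub_zero, add_zero]
      exact sub_le_self _ (qf_nonneg hP.2.posSemidef _))
  rwa [zero_add, mul_assoc, hiy] at h

lemma isSupersolution_of_mixtureBound (hP : IsAdmissible γ P) (hR : R.PosDef) (hA : IsUnit A)
    (hγ : γ ≠ 0) (hfix : riccatiOp A B Q R γ P = P)
    (hbound : ∀ θ σ : ℝ, |θ| ≤ 1 → |σ| ≤ 1 →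
      MixtureBound (gapMatrix γ P) (openLoop A Q γ P - P) (B * gain A B R γ P * A⁻¹) θ σ) :
    IsSupersolution A B Q R γ P := by
  intro x v y
  obtain ⟨σ, hσ, hval⟩ := exists_eq_satValue (gainCost A B R γ P v)
    (y + corr A B γ x (satInput A B R γ P x y) v)
  have hD : qf (openLoop A Q γ P - P) v = gainCost A B R γ P v := by
    simpa only [hfix] using qf_openLoop_sub_riccatiOp A B Q (R := R) (γ := γ) (P := P) v
  have hmix := (mixtureBound_iff_mixedStage_le A B Q hP hR hA hγ).1
    (hbound (sat (y / gainCost A B R γ P x)) σ (abs_sat_le_one _) hσ) x v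
  rw [hD] at hmix
  rw [concealed, ← hval, hfix]
  exact stage_satInput_add_le hP hR hσ hmix

lemma concealed_gainCost (hP : IsAdmissible γ P) (hR : R.PosDef) (x : Fin n → ℝ) :
    concealed A B Q R γ P x (gainCost A B R γ P x)
      = qf (riccatiOp A B Q R γ P) x + 2 * gainCost A B R γ P x := by
  rw [concealed, satValue, abs_of_nonneg (gainCost_nonneg A B hP hR x), if_pos le_rfl]

lemma qf_sub_gain_le (hP : IsAdmissible γ P) (hR : R.PosDef) {x : Fin n → ℝ} {u : Fin m → ℝ}
    {δ : ℝ}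
    (h : ∀ v, stage A B Q R γ x u v + revealed P v (gainCost A B R γ P x + corr A B γ x u v)
      ≤ concealed A B Q R γ P x (gainCost A B R γ P x) + δ) :
    qf (inputMatrix B R γ P) (u - gain A B R γ P *ᵥ x) ≤ δ := by
  obtain ⟨v, hv⟩ := exists_mixedStage_add_qf_eq A B Q hP hR x u (Or.inl rfl)
  have hδ := h v
  rw [concealed_gainCost hP hR, revealed] at hδ
  rw [one_smul, mixedStage] at hv
  linarith [le_abs_self (gainCost A B R γ P x + corr A B γ x u v)]

lemma mixtureBound_of_forall_exists_input (hP : IsAdmissible γ P) (hR : R.PosDef)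
    (hA : IsUnit A) (hγ : γ ≠ 0) (hfix : riccatiOp A B Q R γ P = P)
    (h : ∀ x, ∀ δ > 0, ∃ u, ∀ v, stage A B Q R γ x u v
        + concealed A B Q R γ P v (gainCost A B R γ P x + corr A B γ x u v)
      ≤ concealed A B Q R γ P x (gainCost A B R γ P x) + δ)
    {σ : ℝ} (hσ : |σ| ≤ 1) :
    MixtureBound (gapMatrix γ P) (openLoop A Q γ P - P) (B * gain A B R γ P * A⁻¹) 1 σ := by
  refine (mixtureBound_iff_mixedStage_le A B Q hP hR hA hγ).2 fun x v => ?_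
  choose u hu using fun j : ℕ => h x (1 / ((j : ℝ) + 1)) Nat.one_div_pos_of_nat
  have hδ : Tendsto (fun j : ℕ => 1 / ((j : ℝ) + 1)) atTop (𝓝 0) :=
    tendsto_one_div_add_atTop_nhds_zero_nat
  have hlim : Tendsto u atTop (𝓝 (gain A B R γ P *ᵥ x)) := by
    refine tendsto_of_tendsto_qf_sub (hP.posDef_inputMatrix B hR) (squeeze_zero
      (fun j => qf_nonneg (hP.posDef_inputMatrix B hR).posSemidef _)
      (fun j => qf_sub_gain_le hP hR fun v => (add_le_add_right ?_ _).trans (hu j v)) hδ)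
    simpa only [hfix] using revealed_riccatiOp_le_concealed A B Q (R := R) (γ := γ) (P := P) v _
  have hcont : Continuous fun u => mixedStage A B Q R γ σ x u v := by
    have := continuous_qf R
    unfold mixedStage stage corr
    fun_prop
  have hbound : ∀ j, mixedStage A B Q R γ σ x (u j) v ≤ qf P x + 2 * gainCost A B R γ P x
      + 1 / ((j : ℝ) + 1) - qf P v - (1 - σ ^ 2) * gainCost A B R γ P v
      - 2 * σ * gainCost A B R γ P x := fun j => by
    have hj := hu j v
    have hsat := le_satValue (d := gainCost A B R γ P v)
      (y := gainCost A B R γ P x + corr A B γ x (u j) v) hσ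
    rw [concealed_gainCost hP hR, concealed, hfix] at hj
    rw [mixedStage]
    linarith
  have hle := le_of_tendsto_of_tendsto' ((hcont.tendsto _).comp hlim)
    ((((hδ.const_add _).sub_const _).sub_const _).sub_const _) hbound
  have hopen (z) := qf_riccatiOp A B Q (R := R) (γ := γ) (P := P) z
  rw [hfix] at hopen
  rw [one_smul, qf_matrix_sub]
  linarith [hopen x, congrArg ((1 - σ ^ 2) * ·) (hopen v)]

end OneStep

/-! ### The data matrix -/

/-- The part `γ² ‖diag{I, A}ᵀ‖²_Z` of `γ² ‖[I  iA]ᵀ‖²_Z` that does not depend on the sign `i`. -/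
def diagCost (A : Matrix (Fin n) (Fin n) ℝ) (γ : ℝ) (Z : ZMat n) : ℝ :=
  γ ^ 2 * matSq (fromBlocks (1 : Matrix (Fin n) (Fin n) ℝ) 0 0 A)ᵀ Z

/-- A function `L` of the state and of `y = ⟨A, Y⟩` as a function of the state and of `Z`, with the
term `-γ² ‖diag{I, A}ᵀ‖²_Z` common to all value functions restored. -/
def lift (A : Matrix (Fin n) (Fin n) ℝ) (γ : ℝ) (L : (Fin n → ℝ) → ℝ → ℝ) (x : Fin n → ℝ)
    (Z : ZMat n) : EReal :=
  ((L x (innerAY A γ Z) - diagCost A γ Z : ℝ) : EReal)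

section Data

variable (A : Matrix (Fin n) (Fin n) ℝ) (B : Matrix (Fin n) (Fin m) ℝ)
  (Q : Matrix (Fin n) (Fin n) ℝ) (R : Matrix (Fin m) (Fin m) ℝ) (γ : ℝ)

lemma matSq_fromCols_one (Z : ZMat n) :
    matSq (fromCols (1 : Matrix (Fin n) (Fin n) ℝ) A)ᵀ Z
      = Z.toBlocks₁₁.trace + (A * Z.toBlocks₂₁).trace + (Z.toBlocks₁₂ * Aᵀ).trace
        + (A * Z.toBlocks₂₂ * Aᵀ).trace := by
  conv_lhs => rw [← fromBlocks_toBlocks Z]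
  rw [matSq, transpose_transpose, fromCols_mul_fromBlocks, transpose_fromCols,
    fromCols_mul_fromRows]
  simp only [transpose_one, Matrix.one_mul, Matrix.mul_one, Matrix.add_mul, trace_add]
  ring

lemma matSq_fromBlocks_one (Z : ZMat n) :
    matSq (fromBlocks (1 : Matrix (Fin n) (Fin n) ℝ) 0 0 A)ᵀ Z
      = Z.toBlocks₁₁.trace + (A * Z.toBlocks₂₂ * Aᵀ).trace := by
  conv_lhs => rw [← fromBlocks_toBlocks Z]
  rw [matSq, transpose_transpose, fromBlocks_transpose, fromBlocks_multiply, fromBlocks_multiply]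
  simp [trace, Fintype.sum_sum_type]

lemma toBlocks₂₁_eq {Z : ZMat n} (hZ : Z.IsSymm) : Z.toBlocks₂₁ = Z.toBlocks₁₂ᵀ :=
  Matrix.ext fun i j => hZ.apply (Sum.inl j) (Sum.inr i)

lemma sq_mul_matSq_fromCols_smul {Z : ZMat n} (hZ : Z.IsSymm) {i : ℝ} (hi : i = 1 ∨ i = -1) :
    γ ^ 2 * matSq (fromCols (1 : Matrix (Fin n) (Fin n) ℝ) (i • A))ᵀ Z
      = diagCost A γ Z + 2 * i * innerAY A γ Z := by
  have h₂₁ : (A * Z.toBlocks₁₂ᵀ).trace = (Aᵀ * Z.toBlocks₁₂).trace := by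
    rw [← trace_transpose, transpose_mul, transpose_transpose, trace_mul_comm]
  have h₁₂ : (Z.toBlocks₁₂ * Aᵀ).trace = (Aᵀ * Z.toBlocks₁₂).trace := trace_mul_comm _ _
  have hsq : i * i = 1 := by rw [← sq, sq_eq_one_iff.2 hi]
  rw [matSq_fromCols_one, diagCost, matSq_fromBlocks_one, innerAY, toBlocks₂₁_eq hZ]
  simp only [transpose_smul, Matrix.smul_mul, Matrix.mul_smul, trace_smul, smul_smul, hsq,
    smul_eq_mul, h₂₁, h₁₂, one_mul]
  ring

lemma sq_mul_minSign {Z : ZMat n} (hZ : Z.IsSymm) :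
    γ ^ 2 * minSign A Z = diagCost A γ Z - 2 * |innerAY A γ Z| := by
  have hpos := sq_mul_matSq_fromCols_smul A γ hZ (Or.inl rfl)
  have hneg := sq_mul_matSq_fromCols_smul A γ hZ (Or.inr rfl)
  rw [one_smul] at hpos
  rw [neg_one_smul] at hneg
  have hmin (a : ℝ) : min a (-a) = -|a| := by rw [abs_eq_max_neg, ← min_neg_neg, neg_neg, min_comm]
  rw [minSign, mul_min_of_nonneg _ _ (sq_nonneg γ), hpos, hneg, min_add_add_left, mul_one,
    mul_neg_one, neg_mul, hmin, abs_mul, abs_two, sub_eq_add_neg]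

lemma posSemidef_updateZ {Z : ZMat n} (hZ : Z.PosSemidef) (x v : Fin n → ℝ) (u : Fin m → ℝ) :
    (updateZ B x Z u v).PosSemidef :=
  hZ.add (posSemidef_vecMulVec_self_star _)

lemma innerAY_zero : innerAY A γ 0 = 0 := by
  rw [innerAY, show (0 : ZMat n).toBlocks₁₂ = 0 from rfl, smul_zero, Matrix.mul_zero, trace_zero]

lemma innerAY_add (Z Z' : ZMat n) : innerAY A γ (Z + Z') = innerAY A γ Z + innerAY A γ Z' := by
  rw [innerAY, innerAY, innerAY, ← trace_add, ← Matrix.mul_add, ← smul_add]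
  rfl

lemma diagCost_add (Z Z' : ZMat n) :
    diagCost A γ (Z + Z') = diagCost A γ Z + diagCost A γ Z' := by
  simp only [diagCost, matSq, Matrix.add_mul, trace_add, mul_add]

lemma innerAY_vecMulVec (a x : Fin n → ℝ) :
    innerAY A γ (vecMulVec (Sum.elim a x) (Sum.elim a x)) = γ ^ 2 * (a ⬝ᵥ (A *ᵥ x)) := by
  have hblock : (vecMulVec (Sum.elim a x) (Sum.elim a x)).toBlocks₁₂ = vecMulVec a x := rfl
  rw [innerAY, hblock, Matrix.mul_smul, trace_smul, mul_vecMulVec, trace_vecMulVec, smul_eq_mul,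
    dotProduct_comm, dotProduct_transpose_mulVec]

lemma diagCost_vecMulVec (a x : Fin n → ℝ) :
    diagCost A γ (vecMulVec (Sum.elim a x) (Sum.elim a x))
      = γ ^ 2 * (a ⬝ᵥ a) + γ ^ 2 * ((A *ᵥ x) ⬝ᵥ (A *ᵥ x)) := by
  have h₁₁ : (vecMulVec (Sum.elim a x) (Sum.elim a x)).toBlocks₁₁ = vecMulVec a a := rfl
  have h₂₂ : (vecMulVec (Sum.elim a x) (Sum.elim a x)).toBlocks₂₂ = vecMulVec x x := rfl
  rw [diagCost, matSq_fromBlocks_one, h₁₁, h₂₂, trace_vecMulVec, mul_vecMulVec, vecMulVec_mul,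
    trace_vecMulVec, vecMul_transpose, mul_add]

lemma innerAY_updateZ (Z : ZMat n) (x v : Fin n → ℝ) (u : Fin m → ℝ) :
    innerAY A γ (updateZ B x Z u v) = innerAY A γ Z + corr A B γ x u v := by
  rw [updateZ, innerAY_add, innerAY_vecMulVec, corr]

lemma diagCost_updateZ (Z : ZMat n) (x v : Fin n → ℝ) (u : Fin m → ℝ) :
    diagCost A γ (updateZ B x Z u v) = diagCost A γ Z
      + (γ ^ 2 * ((B *ᵥ u - v) ⬝ᵥ (B *ᵥ u - v)) + γ ^ 2 * ((A *ᵥ x) ⬝ᵥ (A *ᵥ x))) := by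
  rw [updateZ, diagCost_add, diagCost_vecMulVec]

lemma coe_add_lift_updateZ (L : (Fin n → ℝ) → ℝ → ℝ) (x : Fin n → ℝ) (Z : ZMat n)
    (u : Fin m → ℝ) (v : Fin n → ℝ) :
    ((qf Q x + qf R u : ℝ) : EReal) + lift A γ L v (updateZ B x Z u v)
      = ((stage A B Q R γ x u v + L v (innerAY A γ Z + corr A B γ x u v)
          - diagCost A γ Z : ℝ) : EReal) := by
  rw [lift, ← EReal.coe_add, innerAY_updateZ, diagCost_updateZ, stage]
  congr 1
  ring

variable {A γ}

lemma exists_posSemidef_innerAY_eq (hA : IsUnit A) (hγ : γ ≠ 0) {x : Fin n → ℝ} (hx : x ≠ 0)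
    (y : ℝ) : ∃ Z : ZMat n, Z.PosSemidef ∧ innerAY A γ Z = y := by
  have hAx : A *ᵥ x ≠ 0 := fun h =>
    hx (mulVec_injective_iff_isUnit.2 hA (h.trans (mulVec_zero A).symm))
  have hne : (A *ᵥ x) ⬝ᵥ (A *ᵥ x) ≠ 0 := dotProduct_self_eq_zero.not.2 hAx
  refine ⟨_, posSemidef_vecMulVec_self_star
    (Sum.elim ((y / (γ ^ 2 * ((A *ᵥ x) ⬝ᵥ (A *ᵥ x)))) • (A *ᵥ x)) x), ?_⟩
  rw [star_trivial, innerAY_vecMulVec, smul_dotProduct, smul_eq_mul]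
  field_simp

end Data

/-! ### The Bellman operator -/

section Bellman

variable {A : Matrix (Fin n) (Fin n) ℝ} {B : Matrix (Fin n) (Fin m) ℝ}
  {Q : Matrix (Fin n) (Fin n) ℝ} {R : Matrix (Fin m) (Fin m) ℝ} {γ : ℝ}
  {P : Matrix (Fin n) (Fin n) ℝ} {W : (Fin n → ℝ) → ZMat n → EReal}
  {L : (Fin n → ℝ) → ℝ → ℝ} {x : Fin n → ℝ} {Z : ZMat n} {r : ℝ}

lemma lift_mono {L' : (Fin n → ℝ) → ℝ → ℝ} (h : ∀ x y, L x y ≤ L' x y) (x : Fin n → ℝ)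
    (Z : ZMat n) : lift A γ L x Z ≤ lift A γ L' x Z :=
  EReal.coe_le_coe_iff.2 (sub_le_sub_right (h _ _) _)

lemma le_bellman (hW : ∀ v Z, Z.PosSemidef → lift A γ L v Z ≤ W v Z) (hZ : Z.PosSemidef)
    (h : ∀ u, ∃ v, r ≤ stage A B Q R γ x u v + L v (innerAY A γ Z + corr A B γ x u v)) :
    ((r - diagCost A γ Z : ℝ) : EReal) ≤ bellman B Q R W x Z := by
  refine le_iInf fun u => ?_
  obtain ⟨v, hv⟩ := h u
  refine le_iSup_of_le v (le_trans ?_ (add_le_add_right (hW v _ (posSemidef_updateZ B hZ x v u)) _))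
  rw [coe_add_lift_updateZ]
  exact EReal.coe_le_coe_iff.2 (sub_le_sub_right hv _)

lemma bellman_le (hW : ∀ v Z, Z.PosSemidef → W v Z ≤ lift A γ L v Z) (hZ : Z.PosSemidef)
    (u : Fin m → ℝ)
    (h : ∀ v, stage A B Q R γ x u v + L v (innerAY A γ Z + corr A B γ x u v) ≤ r) :
    bellman B Q R W x Z ≤ ((r - diagCost A γ Z : ℝ) : EReal) := by
  refine iInf_le_of_le u (iSup_le fun v => ?_)
  refine (add_le_add_right (hW v _ (posSemidef_updateZ B hZ x v u)) _).trans ?_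
  rw [coe_add_lift_updateZ]
  exact EReal.coe_le_coe_iff.2 (sub_le_sub_right (h v) _)

lemma exists_input_of_bellman_le (hW : ∀ v Z, Z.PosSemidef → lift A γ L v Z ≤ W v Z)
    (hZ : Z.PosSemidef) (h : bellman B Q R W x Z ≤ ((r - diagCost A γ Z : ℝ) : EReal)) {δ : ℝ}
    (hδ : 0 < δ) :
    ∃ u, ∀ v, stage A B Q R γ x u v + L v (innerAY A γ Z + corr A B γ x u v) ≤ r + δ := by
  have hlt : bellman B Q R W x Z < ((r + δ - diagCost A γ Z : ℝ) : EReal) :=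
    h.trans_lt (EReal.coe_lt_coe_iff.2 (sub_lt_sub_right (lt_add_of_pos_right r hδ) _))
  obtain ⟨u, hu⟩ := iInf_lt_iff.1 hlt
  refine ⟨u, fun v => ?_⟩
  have hv := (add_le_add_right (hW v _ (posSemidef_updateZ B hZ x v u)) _).trans
    ((le_iSup (fun v => ((qf Q x + qf R u : ℝ) : EReal) + W v (updateZ B x Z u v)) v).trans hu.le)
  rw [coe_add_lift_updateZ] at hv
  exact (sub_le_sub_iff_right _).1 (EReal.coe_le_coe_iff.1 hv)

lemma V_zero_eq (x : Fin n → ℝ) (hZ : Z.IsSymm) :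
    V A B Q R γ 0 x Z = lift A γ (revealed 0) x Z := by
  simp only [V, lift, revealed, qf_matrix_zero, sq_mul_minSign A γ hZ, neg_sub, zero_add]

lemma Vbar_zero_eq (x : Fin n → ℝ) (hZ : Z.IsSymm) :
    Vbar A B Q R γ P 0 x Z = lift A γ (revealed P) x Z := by
  simp only [Vbar, lift, revealed, sq_mul_minSign A γ hZ, sub_sub_eq_add_sub]

lemma Vstar_eq (hT : Tmat A Q γ P = openLoop A Q γ P) (hfix : riccatiOp A B Q R γ P = P)
    (x : Fin n → ℝ) (hZ : Z.IsSymm) :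
    (Vstar A Q γ P x Z : EReal) = lift A γ (concealed A B Q R γ P) x Z := by
  have hD := qf_openLoop_sub_riccatiOp A B Q (R := R) (γ := γ) (P := P) x
  have hopen := qf_riccatiOp A B Q (R := R) (γ := γ) (P := P) x
  rw [hfix] at hD hopen
  rw [Vstar, lift, concealed, satValue, hT, hD, hfix]
  congr 1
  split_ifs
  · rw [sq_mul_minSign A γ hZ]
    ring
  · rw [diagCost, hopen]
    ring

lemma lift_revealed_le_Vbar (hP : IsAdmissible γ P) (hR : R.PosDef)
    (hfix : riccatiOp A B Q R γ P = P) (k : ℕ) (x : Fin n → ℝ) (Z : ZMat n)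
    (hZ : Z.PosSemidef) : lift A γ (revealed P) x Z ≤ Vbar A B Q R γ P k x Z := by
  induction k generalizing x Z with
  | zero => exact (Vbar_zero_eq x (isSymm_of_posSemidef hZ)).ge
  | succ k ih =>
    refine le_bellman ih hZ fun u => ?_
    obtain ⟨v, hv⟩ := exists_concealed_le A B Q hP hR x u (innerAY A γ Z)
    have hle := revealed_riccatiOp_le_concealed A B Q (R := R) (γ := γ) (P := P) x (innerAY A γ Z)
    rw [hfix] at hle
    exact ⟨v, hle.trans hv⟩

lemma lift_concealed_le_Vbar_succ (hP : IsAdmissible γ P) (hR : R.PosDef)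
    (hfix : riccatiOp A B Q R γ P = P) (k : ℕ) (x : Fin n → ℝ) (Z : ZMat n)
    (hZ : Z.PosSemidef) :
    lift A γ (concealed A B Q R γ P) x Z ≤ Vbar A B Q R γ P (k + 1) x Z :=
  le_bellman (lift_revealed_le_Vbar hP hR hfix k) hZ fun u =>
    exists_concealed_le A B Q hP hR x u _

lemma Vbar_one_eq (hP : IsAdmissible γ P) (hR : R.PosDef) (hfix : riccatiOp A B Q R γ P = P)
    (x : Fin n → ℝ) (Z : ZMat n) (hZ : Z.PosSemidef) :
    Vbar A B Q R γ P 1 x Z = lift A γ (concealed A B Q R γ P) x Z :=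
  le_antisymm
    (bellman_le (fun v _ hZ => (Vbar_zero_eq v (isSymm_of_posSemidef hZ)).le) hZ _ fun v =>
      stage_satInput_add_revealed_le hP hR x v _)
    (lift_concealed_le_Vbar_succ hP hR hfix 0 x Z hZ)

lemma IsSupersolution.bellman_le (h : IsSupersolution A B Q R γ P)
    (hW : ∀ v Z, Z.PosSemidef → W v Z ≤ lift A γ (concealed A B Q R γ P) v Z) (x : Fin n → ℝ)
    (Z : ZMat n) (hZ : Z.PosSemidef) :
    bellman B Q R W x Z ≤ lift A γ (concealed A B Q R γ P) x Z :=
  SignGame.bellman_le hW hZ _ fun v => h x v _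

lemma IsSupersolution.Vbar_succ_eq (h : IsSupersolution A B Q R γ P) (hP : IsAdmissible γ P)
    (hR : R.PosDef) (hfix : riccatiOp A B Q R γ P = P) (k : ℕ) (x : Fin n → ℝ) (Z : ZMat n)
    (hZ : Z.PosSemidef) :
    Vbar A B Q R γ P (k + 1) x Z = lift A γ (concealed A B Q R γ P) x Z := by
  induction k generalizing x Z with
  | zero => exact Vbar_one_eq hP hR hfix x Z hZ
  | succ k ih =>
    exact le_antisymm (h.bellman_le (fun v Z hZ => (ih v Z hZ).le) x Z hZ)
      (lift_concealed_le_Vbar_succ hP hR hfix (k + 1) x Z hZ)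

lemma IsSupersolution.V_le (h : IsSupersolution A B Q R γ P) (hP : P.PosSemidef)
    (hfix : riccatiOp A B Q R γ P = P) (k : ℕ) (x : Fin n → ℝ) (Z : ZMat n)
    (hZ : Z.PosSemidef) : V A B Q R γ k x Z ≤ lift A γ (concealed A B Q R γ P) x Z := by
  induction k generalizing x Z with
  | zero =>
    have hzero (x y) : revealed 0 x y ≤ revealed P x y := by
      rw [revealed, revealed, qf_matrix_zero]
      exact add_le_add_left (qf_nonneg hP x) _
    have hle := revealed_riccatiOp_le_concealed A B Q (R := R) (γ := γ) (P := P)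
    rw [hfix] at hle
    rw [V_zero_eq x (isSymm_of_posSemidef hZ)]
    exact lift_mono (fun x y => (hzero x y).trans (hle x y)) x Z
  | succ k ih => exact h.bellman_le ih x Z hZ

lemma exists_posSemidef_innerAY_eq_gainCost (hA : IsUnit A) (hγ : γ ≠ 0) (x : Fin n → ℝ) :
    ∃ Z : ZMat n, Z.PosSemidef ∧ innerAY A γ Z = gainCost A B R γ P x := by
  rcases eq_or_ne x 0 with rfl | hx
  · exact ⟨0, PosSemidef.zero, by rw [innerAY_zero, gainCost, mulVec_zero, qf_zero]⟩
  · exact exists_posSemidef_innerAY_eq hA hγ hx _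

lemma mixtureBound_of_Vbar_two_eq (hP : IsAdmissible γ P) (hR : R.PosDef) (hA : IsUnit A)
    (hγ : γ ≠ 0) (hfix : riccatiOp A B Q R γ P = P)
    (h : ∀ (x : Fin n → ℝ) (Z : ZMat n), Z.PosSemidef →
      Vbar A B Q R γ P 2 x Z = Vbar A B Q R γ P 1 x Z)
    {σ : ℝ} (hσ : |σ| ≤ 1) :
    MixtureBound (gapMatrix γ P) (openLoop A Q γ P - P) (B * gain A B R γ P * A⁻¹) 1 σ := by
  refine mixtureBound_of_forall_exists_input hP hR hA hγ hfix (fun x δ hδ => ?_) hσ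
  obtain ⟨Z, hZ, hy⟩ :=
    exists_posSemidef_innerAY_eq_gainCost (B := B) (R := R) (P := P) hA hγ x
  have hle : bellman B Q R (Vbar A B Q R γ P 1) x Z ≤ lift A γ (concealed A B Q R γ P) x Z :=
    ((h x Z hZ).trans (Vbar_one_eq hP hR hfix x Z hZ)).le
  rw [← hy]
  exact exists_input_of_bellman_le (fun v Z hZ => (Vbar_one_eq hP hR hfix v Z hZ).ge) hZ hle hδ

end Bellman

/-! ### The Riccati iteration -/

/-- The Riccati iteration started at zero; its iterates bound the value iteration `V` from below. -/
def riccatiSeq (A : Matrix (Fin n) (Fin n) ℝ) (B : Matrix (Fin n) (Fin m) ℝ)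
    (Q : Matrix (Fin n) (Fin n) ℝ) (R : Matrix (Fin m) (Fin m) ℝ) (γ : ℝ) (k : ℕ) :
    Matrix (Fin n) (Fin n) ℝ :=
  (riccatiOp A B Q R γ)^[k] 0

lemma continuousAt_matrix_mul {X ι κ l : Type*} [TopologicalSpace X] [Fintype κ]
    {f : X → Matrix ι κ ℝ} {g : X → Matrix κ l ℝ} {a : X}
    (hf : ContinuousAt f a) (hg : ContinuousAt g a) : ContinuousAt (fun y => f y * g y) a :=
  (Continuous.matrix_mul continuous_fst continuous_snd).continuousAt.comp
    (f := fun y => (f y, g y)) (hf.prodMk hg)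

lemma continuousAt_inv_of_posDef {ι : Type*} [Fintype ι] [DecidableEq ι] {M : Matrix ι ι ℝ}
    (hM : M.PosDef) : ContinuousAt (fun N : Matrix ι ι ℝ => N⁻¹) M := by
  refine continuousAt_matrix_inv M ?_
  rw [Ring.inverse_eq_inv']
  exact continuousAt_inv₀ hM.det_pos.ne'

lemma exists_tendsto_of_monotone_qf {k : ℕ} {S : ℕ → Matrix (Fin k) (Fin k) ℝ}
    (hsymm : ∀ j, (S j).IsSymm) (hmono : ∀ x, Monotone fun j => qf (S j) x)
    (hbdd : ∀ x, BddAbove (Set.range fun j => qf (S j) x)) : ∃ M, Tendsto S atTop (𝓝 M) := by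
  have hqf (x) := tendsto_atTop_ciSup (hmono x) (hbdd x)
  have hentry (a b) : ∃ l, Tendsto (fun j => S j a b) atTop (𝓝 l) := by
    refine ⟨_, ((((hqf (Pi.single a 1 + Pi.single b 1)).sub (hqf (Pi.single a 1))).sub
      (hqf (Pi.single b 1))).div_const 2).congr fun j => ?_⟩
    rw [qf_add (hsymm j)]
    simp only [mulVec_single_one, single_one_dotProduct, col_apply]
    ring
  choose M hM using hentry
  exact ⟨M, tendsto_pi_nhds.2 fun a => tendsto_pi_nhds.2 fun b => hM a b⟩

section Iteration

variable {A : Matrix (Fin n) (Fin n) ℝ} {B : Matrix (Fin n) (Fin m) ℝ}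
  {Q : Matrix (Fin n) (Fin n) ℝ} {R : Matrix (Fin m) (Fin m) ℝ} {γ : ℝ}
  {P : Matrix (Fin n) (Fin n) ℝ}

lemma IsAdmissible.continuousAt_worstMatrix (hP : IsAdmissible γ P) :
    ContinuousAt (worstMatrix γ) P := by
  have hgap : ContinuousAt (gapMatrix γ) P := by
    unfold gapMatrix
    fun_prop
  exact (((continuousAt_inv_of_posDef hP.2).comp hgap).const_smul ((γ ^ 2) ^ 2)).sub
    continuousAt_const

variable (A Q) in
lemma IsAdmissible.continuousAt_openLoop (hP : IsAdmissible γ P) :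
    ContinuousAt (openLoop A Q γ) P :=
  continuousAt_const.add (continuousAt_matrix_mul
    (continuousAt_matrix_mul continuousAt_const hP.continuousAt_worstMatrix) continuousAt_const)

variable (A B Q) in
lemma IsAdmissible.continuousAt_riccatiOp (hP : IsAdmissible γ P) (hR : R.PosDef) :
    ContinuousAt (riccatiOp A B Q R γ) P := by
  have hworst := hP.continuousAt_worstMatrix
  have hinput : ContinuousAt (inputMatrix B R γ) P :=
    continuousAt_const.add (continuousAt_matrix_mul
      (continuousAt_matrix_mul continuousAt_const hworst) continuousAt_const)
  have hgain : ContinuousAt (gain A B R γ) P :=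
    continuousAt_matrix_mul
      ((continuousAt_inv_of_posDef (hP.posDef_inputMatrix B hR)).comp hinput)
      (continuousAt_matrix_mul (continuousAt_matrix_mul continuousAt_const hworst)
        continuousAt_const)
  exact (hP.continuousAt_openLoop A Q).sub (continuousAt_matrix_mul (continuousAt_matrix_mul
    (continuous_id.matrix_transpose.continuousAt.comp hgain) hinput) hgain)

lemma riccatiSeq_succ (k : ℕ) :
    riccatiSeq A B Q R γ (k + 1) = riccatiOp A B Q R γ (riccatiSeq A B Q R γ k) :=
  Function.iterate_succ_apply' _ _ _

lemma isAdmissible_riccatiSeq_and_le (hP : IsAdmissible γ P) (hQ : Q.PosSemidef) (hR : R.PosDef)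
    (hfix : riccatiOp A B Q R γ P = P) (k : ℕ) :
    IsAdmissible γ (riccatiSeq A B Q R γ k) ∧ ∀ x, qf (riccatiSeq A B Q R γ k) x ≤ qf P x := by
  induction k with
  | zero =>
    have hle (x) : qf 0 x ≤ qf P x := (qf_matrix_zero x).trans_le (qf_nonneg hP.1 x)
    exact ⟨hP.of_le PosSemidef.zero hle, hle⟩
  | succ k ih =>
    have hle (x) : qf (riccatiSeq A B Q R γ (k + 1)) x ≤ qf P x := by
      simpa only [riccatiSeq_succ, hfix] using qf_riccatiOp_mono A B Q ih.1 hP hR ih.2 x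
    refine ⟨hP.of_le ?_ hle, hle⟩
    rw [riccatiSeq_succ]
    exact ih.1.posSemidef_riccatiOp A B hQ hR

lemma monotone_qf_riccatiSeq (hadm : ∀ k, IsAdmissible γ (riccatiSeq A B Q R γ k))
    (hR : R.PosDef) (x : Fin n → ℝ) : Monotone fun k => qf (riccatiSeq A B Q R γ k) x := by
  refine monotone_nat_of_le_succ fun k => ?_
  induction k generalizing x with
  | zero => exact (qf_matrix_zero x).trans_le (qf_nonneg (hadm 1).1 x)
  | succ k ih =>
    rw [riccatiSeq_succ, riccatiSeq_succ]
    exact qf_riccatiOp_mono A B Q (hadm k) (hadm (k + 1)) hR ih x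

lemma exists_tendsto_riccatiSeq (hP : IsAdmissible γ P) (hQ : Q.PosSemidef) (hR : R.PosDef)
    (hfix : riccatiOp A B Q R γ P = P) :
    ∃ L, L.PosSemidef ∧ (∀ x, qf L x ≤ qf P x) ∧
      Tendsto (riccatiSeq A B Q R γ) atTop (𝓝 L) := by
  have hseq := isAdmissible_riccatiSeq_and_le hP hQ hR hfix
  obtain ⟨L, hL⟩ := exists_tendsto_of_monotone_qf (fun k => (hseq k).1.isSymm)
    (monotone_qf_riccatiSeq (fun k => (hseq k).1) hR)
    (fun x => ⟨qf P x, Set.forall_mem_range.2 fun k => (hseq k).2 x⟩)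
  have hqf (x) : Tendsto (fun k => qf (riccatiSeq A B Q R γ k) x) atTop (𝓝 (qf L x)) :=
    ((continuous_qf_matrix x).tendsto L).comp hL
  have hsymm : L.IsSymm :=
    tendsto_nhds_unique ((continuous_id.matrix_transpose.tendsto L).comp hL)
      (hL.congr fun k => (hseq k).1.isSymm.eq.symm)
  exact ⟨L, posSemidef_of_qf_nonneg hsymm fun x =>
    ge_of_tendsto' (hqf x) fun k => qf_nonneg (hseq k).1.1 x,
    fun x => le_of_tendsto' (hqf x) fun k => (hseq k).2 x, hL⟩

lemma tendsto_riccatiSeq (hQ : Q.PosDef) (hR : R.PosDef)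
    (hP : IsLeastRiccatiSolution A B Q R γ P) :
    Tendsto (riccatiSeq A B Q R γ) atTop (𝓝 P) := by
  have hadm := hP.1.isAdmissible
  obtain ⟨L, hL, hle, hlim⟩ := exists_tendsto_riccatiSeq hadm hQ.posSemidef hR
    (hP.1.riccatiOp_eq (isSymm_of_posDef hQ) hR)
  have hLadm := hadm.of_le hL hle
  have hLfix : riccatiOp A B Q R γ L = L :=
    isFixedPt_of_tendsto_iterate hlim (hLadm.continuousAt_riccatiOp A B Q hR)
  have hleast := hP.2 L (isRiccatiSolution_of_riccatiOp_eq hLadm hQ hR hLfix)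
  have heq : L = P := eq_of_qf_eq hLadm.isSymm hadm.isSymm fun x =>
    le_antisymm (hle x) (sub_nonneg.1 ((qf_nonneg hleast x).trans_eq (qf_matrix_sub L P x)))
  rwa [heq] at hlim

lemma lift_revealed_riccatiSeq_le_V (hadm : ∀ k, IsAdmissible γ (riccatiSeq A B Q R γ k))
    (hR : R.PosDef) (k : ℕ) (x : Fin n → ℝ) (Z : ZMat n) (hZ : Z.PosSemidef) :
    lift A γ (revealed (riccatiSeq A B Q R γ k)) x Z ≤ V A B Q R γ k x Z := by
  induction k generalizing x Z with
  | zero => exact (V_zero_eq x (isSymm_of_posSemidef hZ)).ge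
  | succ k ih =>
    refine le_bellman ih hZ fun u => ?_
    obtain ⟨v, hv⟩ := exists_concealed_le A B Q (hadm k) hR x u (innerAY A γ Z)
    rw [riccatiSeq_succ]
    exact ⟨v, (revealed_riccatiOp_le_concealed A B Q x _).trans hv⟩

lemma tendsto_mixture_riccatiSeq (hP : IsAdmissible γ P) (hR : R.PosDef)
    (hlim : Tendsto (riccatiSeq A B Q R γ) atTop (𝓝 P)) (x : Fin n → ℝ) (c d : ℝ) :
    Tendsto (fun k => qf (riccatiOp A B Q R γ (riccatiSeq A B Q R γ k)) x
        + (c * gainCost A B R γ (riccatiSeq A B Q R γ k) x + d)) atTop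
      (𝓝 (qf (riccatiOp A B Q R γ P) x + (c * gainCost A B R γ P x + d))) := by
  have hric := ((continuous_qf_matrix x).tendsto _).comp
    ((hP.continuousAt_riccatiOp A B Q hR).tendsto.comp hlim)
  have hopen := ((continuous_qf_matrix x).tendsto _).comp
    ((hP.continuousAt_openLoop A Q).tendsto.comp hlim)
  simp only [← qf_openLoop_sub_riccatiOp A B Q, qf_matrix_sub]
  exact hric.add (((hopen.sub hric).const_mul c).add_const d)

lemma IsSupersolution.tendsto_V (h : IsSupersolution A B Q R γ P) (hQ : Q.PosDef) (hR : R.PosDef)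
    (hP : IsLeastRiccatiSolution A B Q R γ P) (x : Fin n → ℝ) (Z : ZMat n)
    (hZ : Z.PosSemidef) :
    Tendsto (fun k => V A B Q R γ k x Z) atTop
      (𝓝 (lift A γ (concealed A B Q R γ P) x Z)) := by
  have hPadm := hP.1.isAdmissible
  have hfix := hP.1.riccatiOp_eq (isSymm_of_posDef hQ) hR
  have hadm (k) := (isAdmissible_riccatiSeq_and_le hPadm hQ.posSemidef hR hfix k).1
  obtain ⟨σ, hσ, hval⟩ := exists_eq_satValue (gainCost A B R γ P x) (innerAY A γ Z)
  have hlower := (tendsto_mixture_riccatiSeq hPadm hR (tendsto_riccatiSeq hQ hR hP) x (1 - σ ^ 2)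
    (2 * σ * innerAY A γ Z)).sub_const (diagCost A γ Z)
  rw [hval] at hlower
  rw [← tendsto_add_atTop_iff_nat 1]
  exact tendsto_of_tendsto_of_tendsto_of_le_of_le
    ((continuous_coe_real_ereal.tendsto _).comp hlower) tendsto_const_nhds
    (fun k => le_bellman (lift_revealed_riccatiSeq_le_V hadm hR k) hZ fun u =>
      exists_le_stage_add_revealed A B Q (hadm k) hR x u _ hσ)
    (fun k => h.V_le hPadm.1 hfix (k + 1) x Z hZ)

end Iteration

/-! ### The game -/

/-- The inputs that the control law `μ` generates along the state sequence `x`. -/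
def inputSeq (μ : ControlLaw n m) (x : ℕ → Fin n → ℝ) (t : ℕ) : Fin m → ℝ :=
  μ t (fun τ => x τ) (fun τ => inputSeq μ x τ)
termination_by t
decreasing_by exact τ.2

/-- The cost of the first `t` steps along `x` and `u`, where the disturbance is the one that
produces `x` when the plant sign is `-σ`. -/
def partialCost (A : Matrix (Fin n) (Fin n) ℝ) (B : Matrix (Fin n) (Fin m) ℝ)
    (Q : Matrix (Fin n) (Fin n) ℝ) (R : Matrix (Fin m) (Fin m) ℝ) (γ σ : ℝ)
    (x : ℕ → Fin n → ℝ) (u : ℕ → Fin m → ℝ) (t : ℕ) : ℝ :=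
  ∑ τ ∈ Finset.range t, mixedStage A B Q R γ σ (x τ) (u τ) (x (τ + 1))

/-- The data `y = ⟨A, Y⟩` collected in the first `t` steps along `x` and `u`. -/
def dataSum (A : Matrix (Fin n) (Fin n) ℝ) (B : Matrix (Fin n) (Fin m) ℝ) (γ : ℝ)
    (x : ℕ → Fin n → ℝ) (u : ℕ → Fin m → ℝ) (t : ℕ) : ℝ :=
  ∑ τ ∈ Finset.range t, corr A B γ (x τ) (u τ) (x (τ + 1))

lemma inputSeq_congr (μ : ControlLaw n m) {x x' : ℕ → Fin n → ℝ} (t : ℕ)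
    (h : ∀ τ ≤ t, x τ = x' τ) : inputSeq μ x t = inputSeq μ x' t := by
  induction t using Nat.strong_induction_on with
  | _ t ih =>
    rw [inputSeq, inputSeq]
    congr 1
    · exact funext fun τ => h τ (Nat.lt_succ_iff.1 τ.2)
    · exact funext fun τ => ih τ τ.2 fun s hs => h s (hs.trans τ.2.le)

section Game

variable {A : Matrix (Fin n) (Fin n) ℝ} {B : Matrix (Fin n) (Fin m) ℝ}
  {Q : Matrix (Fin n) (Fin n) ℝ} {R : Matrix (Fin m) (Fin m) ℝ} {γ : ℝ}
  {P : Matrix (Fin n) (Fin n) ℝ} {μ : ControlLaw n m} {x₀ : Fin n → ℝ}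
  {w x : ℕ → Fin n → ℝ} {u : ℕ → Fin m → ℝ}

lemma IsTrajectory.cost_eq_partialCost {i : ℝ} (h : IsTrajectory A B μ x₀ i w x u)
    (hi : i = 1 ∨ i = -1) (N : ℕ) :
    cost Q R γ w x u N = partialCost A B Q R γ (-i) x u (N + 1) := by
  refine Finset.sum_congr rfl fun t _ => ?_
  have hw : B *ᵥ u t - (-i) • (A *ᵥ x t) - x (t + 1) = -w t := by
    rw [h.2.1 t, neg_smul]
    abel
  rw [mixedStage_eq, hw, neg_dotProduct_neg, neg_sq, sq_eq_one_iff.2 hi]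
  ring

lemma partialCost_eq (σ : ℝ) (x : ℕ → Fin n → ℝ) (u : ℕ → Fin m → ℝ) (t : ℕ) :
    partialCost A B Q R γ σ x u t
      = ∑ τ ∈ Finset.range t, stage A B Q R γ (x τ) (u τ) (x (τ + 1))
        + 2 * σ * dataSum A B γ x u t := by
  rw [dataSum, Finset.mul_sum, ← Finset.sum_add_distrib]
  rfl

lemma partialCost_le_worstCost (μ : ControlLaw n m) {σ : ℝ} (hσ : σ = 1 ∨ σ = -1)
    (x : ℕ → Fin n → ℝ) (N : ℕ) :
    (partialCost A B Q R γ σ x (inputSeq μ x) (N + 1) : EReal)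
      ≤ worstCost A B Q R γ μ (x 0) := by
  have hsign : -σ = 1 ∨ -σ = -1 := hσ.symm.imp (fun h => by rw [h, neg_neg]) (congrArg Neg.neg)
  have htraj : IsTrajectory A B μ (x 0) (-σ)
      (fun t => x (t + 1) - ((-σ) • (A *ᵥ x t) + B *ᵥ inputSeq μ x t)) x (inputSeq μ x) :=
    ⟨rfl, fun t => (add_sub_cancel _ _).symm, fun t => by rw [inputSeq]⟩
  refine le_sSup ⟨-σ, _, x, inputSeq μ x, N, hsign, htraj, ?_⟩
  rw [htraj.cost_eq_partialCost hsign, neg_neg]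

lemma partialCost_update (μ : ControlLaw n m) (σ : ℝ) (x : ℕ → Fin n → ℝ) (t : ℕ)
    (v : Fin n → ℝ) :
    partialCost A B Q R γ σ (Function.update x (t + 1) v)
        (inputSeq μ (Function.update x (t + 1) v)) (t + 1)
      = partialCost A B Q R γ σ x (inputSeq μ x) t
        + mixedStage A B Q R γ σ (x t) (inputSeq μ x t) v := by
  have hx {τ : ℕ} (hτ : τ ≤ t) : Function.update x (t + 1) v τ = x τ :=
    Function.update_of_ne (Nat.lt_succ_of_le hτ).ne _ _
  have hu {τ : ℕ} (hτ : τ ≤ t) :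
      inputSeq μ (Function.update x (t + 1) v) τ = inputSeq μ x τ :=
    inputSeq_congr μ τ fun s hs => hx (hs.trans hτ)
  rw [partialCost, Finset.sum_range_succ, Function.update_self, hx le_rfl, hu le_rfl]
  refine congrArg (· + _) (Finset.sum_congr rfl fun τ hτ => ?_)
  have hlt := Finset.mem_range.1 hτ
  rw [hx hlt.le, hu hlt.le, hx hlt]

lemma exists_extension (hadm : ∀ k, IsAdmissible γ (riccatiSeq A B Q R γ k)) (hR : R.PosDef)
    (μ : ControlLaw n m) {σ : ℝ} (hσ : σ = 1 ∨ σ = -1) (k t : ℕ) (x : ℕ → Fin n → ℝ) :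
    ∃ x' : ℕ → Fin n → ℝ, (∀ τ ≤ t, x' τ = x τ) ∧
      partialCost A B Q R γ σ x (inputSeq μ x) t + qf (riccatiSeq A B Q R γ k) (x t)
        ≤ partialCost A B Q R γ σ x' (inputSeq μ x') (t + k) := by
  induction k generalizing t x with
  | zero => exact ⟨x, fun _ _ => rfl, (congrArg (_ + ·) (qf_matrix_zero _)).trans_le
      (add_zero _).le⟩
  | succ k ih =>
    obtain ⟨v, hv⟩ := exists_mixedStage_add_qf_eq A B Q (hadm k) hR (x t) (inputSeq μ x t) hσ
    obtain ⟨x', hx', hle⟩ := ih (t + 1) (Function.update x (t + 1) v)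
    refine ⟨x', fun τ hτ => (hx' τ (hτ.trans t.le_succ)).trans
      (Function.update_of_ne (Nat.lt_succ_of_le hτ).ne _ _), ?_⟩
    rw [partialCost_update, Function.update_self, add_assoc, hv, add_right_comm t,
      add_assoc t] at hle
    rw [riccatiSeq_succ]
    refine le_trans ?_ hle
    rw [← add_assoc]
    exact le_add_of_nonneg_right (qf_nonneg ((hadm k).posDef_inputMatrix B hR).posSemidef _)

lemma exists_sign_openLoop_le (hP : IsAdmissible γ P) (hR : R.PosDef) (x : Fin n → ℝ)
    (u : Fin m → ℝ) :
    ∃ σ : ℝ, (σ = 1 ∨ σ = -1) ∧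
      ∃ v, qf (openLoop A Q γ P) x ≤ mixedStage A B Q R γ σ x u v + qf P v := by
  obtain ⟨v, hv⟩ := exists_concealed_le A B Q hP hR x u 0
  obtain ⟨σ, hσ, habs⟩ := exists_sign_mul_eq_abs (corr A B γ x u v)
  refine ⟨σ, hσ, v, ?_⟩
  rw [concealed_zero A B Q hP hR, zero_add, revealed, ← habs] at hv
  rw [mixedStage]
  linarith

lemma openLoop_riccatiSeq_le_gameValue (hadm : ∀ k, IsAdmissible γ (riccatiSeq A B Q R γ k))
    (hR : R.PosDef) (x₀ : Fin n → ℝ) (k : ℕ) :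
    (qf (openLoop A Q γ (riccatiSeq A B Q R γ k)) x₀ : EReal) ≤ gameValue A B Q R γ x₀ := by
  refine le_iInf fun μ => ?_
  obtain ⟨σ, hσ, v, hv⟩ := exists_sign_openLoop_le (A := A) (B := B) (Q := Q) (hadm k) hR x₀
    (inputSeq μ (fun _ => x₀) 0)
  obtain ⟨x, hx, hle⟩ := exists_extension hadm hR μ hσ k 1 (Function.update (fun _ => x₀) 1 v)
  have hx₀ : x 0 = x₀ := (hx 0 zero_le_one).trans (Function.update_of_ne zero_ne_one _ _)
  have hworst := partialCost_le_worstCost (A := A) (B := B) (Q := Q) (R := R) (γ := γ) μ hσ x k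
  rw [partialCost_update μ σ _ 0, partialCost, Finset.sum_range_zero, zero_add,
    Function.update_self, add_comm 1 k] at hle
  rw [hx₀] at hworst
  exact (EReal.coe_le_coe_iff.2 (hv.trans hle)).trans hworst

lemma satLaw_eq_satInput (hT : Tmat A Q γ P = openLoop A Q γ P)
    (hfix : riccatiOp A B Q R γ P = P) (t : ℕ) :
    satLaw A B Q γ P (gain A B R γ P) t (fun τ => x τ) (fun τ => u τ)
      = satInput A B R γ P (x t) (dataSum A B γ x u t) := by
  have hdata : γ ^ 2 * ∑ τ : Fin t, (B *ᵥ u τ - x (τ + 1)) ⬝ᵥ (A *ᵥ x τ) = dataSum A B γ x u t := by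
    rw [Fin.sum_univ_eq_sum_range fun τ => (B *ᵥ u τ - x (τ + 1)) ⬝ᵥ (A *ᵥ x τ), Finset.mul_sum]
    rfl
  have hD := qf_openLoop_sub_riccatiOp A B Q (R := R) (γ := γ) (P := P) (x t)
  rw [hfix] at hD
  rw [satInput, ← hdata, ← hD, satLaw, hT]
  rfl

lemma IsSupersolution.sum_stage_add_concealed_le (h : IsSupersolution A B Q R γ P)
    (hu : ∀ t, u t = satInput A B R γ P (x t) (dataSum A B γ x u t)) (t : ℕ) :
    ∑ τ ∈ Finset.range t, stage A B Q R γ (x τ) (u τ) (x (τ + 1))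
      + concealed A B Q R γ P (x t) (dataSum A B γ x u t)
        ≤ concealed A B Q R γ P (x 0) 0 := by
  induction t with
  | zero => rw [dataSum, Finset.sum_range_zero, Finset.sum_range_zero, zero_add]
  | succ t ih =>
    have hstep := h (x t) (x (t + 1)) (dataSum A B γ x u t)
    rw [← hu t] at hstep
    rw [dataSum, Finset.sum_range_succ, Finset.sum_range_succ, ← dataSum]
    linarith

lemma IsSupersolution.worstCost_satLaw_le (h : IsSupersolution A B Q R γ P)
    (hP : IsAdmissible γ P) (hR : R.PosDef) (hfix : riccatiOp A B Q R γ P = P)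
    (hT : Tmat A Q γ P = openLoop A Q γ P) (x₀ : Fin n → ℝ) :
    worstCost A B Q R γ (satLaw A B Q γ P (gain A B R γ P)) x₀
      ≤ (qf (openLoop A Q γ P) x₀ : EReal) := by
  refine sSup_le ?_
  rintro _ ⟨i, w, x, u, N, hi, htraj, rfl⟩
  rw [EReal.coe_le_coe_iff, htraj.cost_eq_partialCost hi, partialCost_eq]
  have hsum := h.sum_stage_add_concealed_le
    (fun t => (htraj.2.2 t).trans (satLaw_eq_satInput hT hfix t)) (N + 1)
  have hrevealed := revealed_riccatiOp_le_concealed A B Q (R := R) (γ := γ) (P := P) (x (N + 1))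
    (dataSum A B γ x u (N + 1))
  have hsign := sign_mul_le_abs (i := -i) (hi.symm.imp (fun h => by rw [h, neg_neg])
    (congrArg Neg.neg)) (dataSum A B γ x u (N + 1))
  rw [htraj.1, concealed_zero A B Q hP hR] at hsum
  rw [hfix, revealed] at hrevealed
  linarith [qf_nonneg hP.1 (x (N + 1))]

end Game

/-! ### The two conditions and the optimal control law -/

section Conditions

variable {A : Matrix (Fin n) (Fin n) ℝ} {B : Matrix (Fin n) (Fin m) ℝ}
  {Q P : Matrix (Fin n) (Fin n) ℝ} {R : Matrix (Fin m) (Fin m) ℝ} {γ : ℝ}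

lemma posDef_openLoop_sub (hP : IsAdmissible γ P) (hQ : Q.IsSymm) (hR : R.PosDef)
    (hfix : riccatiOp A B Q R γ P = P) (hD : IsUnit (openLoop A Q γ P - P)) :
    (openLoop A Q γ P - P).PosDef := by
  refine (PosSemidef.posDef_iff_isUnit (posSemidef_of_qf_nonneg
    ((isSymm_openLoop A hQ hP.isSymm).sub hP.isSymm) fun x => ?_)).2 hD
  have hcost := qf_openLoop_sub_riccatiOp A B Q (R := R) (γ := γ) (P := P) x
  rw [hfix] at hcost
  exact (gainCost_nonneg A B hP hR x).trans_eq hcost.symm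

lemma ConditionI.conditionII (h : ConditionI A B Q R γ P) (hP : IsAdmissible γ P)
    (hR : R.PosDef) (hA : IsUnit A) (hγ : γ ≠ 0) (hfix : riccatiOp A B Q R γ P = P)
    (hT : Tmat A Q γ P = openLoop A Q γ P) (hD : (openLoop A Q γ P - P).PosDef) :
    ConditionII A B Q γ P (gain A B R γ P) := by
  rw [ConditionII, hT]
  exact fun _ hε => posSemidef_of_mixtureBound hP.2 hD (fun _ hσ =>
    mixtureBound_of_Vbar_two_eq hP hR hA hγ hfix (h.2 2 one_le_two) hσ.le) hε

lemma ConditionII.isSupersolution (h : ConditionII A B Q γ P (gain A B R γ P))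
    (hP : IsAdmissible γ P) (hR : R.PosDef) (hA : IsUnit A) (hγ : γ ≠ 0)
    (hfix : riccatiOp A B Q R γ P = P) (hT : Tmat A Q γ P = openLoop A Q γ P)
    (hD : (openLoop A Q γ P - P).PosDef) : IsSupersolution A B Q R γ P := by
  rw [ConditionII, hT] at h
  exact isSupersolution_of_mixtureBound hP hR hA hγ hfix fun _ _ hθ hσ =>
    mixtureBound_of_posSemidef hP.2 hD h hθ hσ

lemma IsSupersolution.conditionI (h : IsSupersolution A B Q R γ P) (hP : IsAdmissible γ P)
    (hQ : Q.PosSemidef) (hR : R.PosDef) (hfix : riccatiOp A B Q R γ P = P)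
    (hT : Tmat A Q γ P = openLoop A Q γ P) : ConditionI A B Q R γ P := by
  refine ⟨fun x₀ => ⟨?_, ?_⟩, fun k hk x Z hZ => ?_⟩
  · exact ne_top_of_le_ne_top (EReal.coe_ne_top _)
      ((iInf_le _ _).trans (h.worstCost_satLaw_le hP hR hfix hT x₀))
  · exact ne_bot_of_le_ne_bot (EReal.coe_ne_bot _) (openLoop_riccatiSeq_le_gameValue
      (fun k => (isAdmissible_riccatiSeq_and_le hP hQ hR hfix k).1) hR x₀ 0)
  · obtain ⟨k, rfl⟩ := Nat.exists_eq_add_of_le' hk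
    rw [h.Vbar_succ_eq hP hR hfix k x Z hZ, Vbar_one_eq hP hR hfix x Z hZ]

lemma IsSupersolution.isOptimal_satLaw (h : IsSupersolution A B Q R γ P) (hQ : Q.PosDef)
    (hR : R.PosDef) (hP : IsLeastRiccatiSolution A B Q R γ P)
    (hT : Tmat A Q γ P = openLoop A Q γ P) :
    IsOptimal A B Q R γ (satLaw A B Q γ P (gain A B R γ P)) := by
  have hadm := hP.1.isAdmissible
  have hfix := hP.1.riccatiOp_eq (isSymm_of_posDef hQ) hR
  refine fun x₀ => le_antisymm ?_ (iInf_le _ _)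
  have hlim := ((continuous_qf_matrix x₀).tendsto _).comp
    ((hadm.continuousAt_openLoop A Q).tendsto.comp (tendsto_riccatiSeq hQ hR hP))
  exact (h.worstCost_satLaw_le hadm hR hfix hT x₀).trans <|
    le_of_tendsto' ((continuous_coe_real_ereal.tendsto _).comp hlim) fun k =>
      openLoop_riccatiSeq_le_gameValue
        (fun k => (isAdmissible_riccatiSeq_and_le hadm hQ.posSemidef hR hfix k).1) hR x₀ k

end Conditions

end SignGame

end

theorem theorem2 {n m : ℕ}
    (A : Matrix (Fin n) (Fin n) ℝ) (B : Matrix (Fin n) (Fin m) ℝ)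
    (Q : Matrix (Fin n) (Fin n) ℝ) (R : Matrix (Fin m) (Fin m) ℝ) (γ : ℝ)
    (hQ : Q.PosDef) (hR : R.PosDef) (hγ : 0 < γ)
    (P : Matrix (Fin n) (Fin n) ℝ) (K : Matrix (Fin m) (Fin n) ℝ)
    (hP : SignGame.IsRiccatiSolution A B Q R γ P)
    (hK : SignGame.IsRiccatiGain A B Q R γ P K)
    -- the two inverses that occur in the matrix inequality exist
    (hA : IsUnit A) (hT : IsUnit (SignGame.Tmat A Q γ P - P)) :
    (SignGame.ConditionI A B Q R γ P ↔ SignGame.ConditionII A B Q γ P K) ∧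
    (SignGame.ConditionI A B Q R γ P → SignGame.ConditionII A B Q γ P K →
      SignGame.IsLeastRiccatiSolution A B Q R γ P →
      SignGame.IsOptimal A B Q R γ (SignGame.satLaw A B Q γ P K) ∧
      ∀ (x : Fin n → ℝ) (Z : SignGame.ZMat n), Z.PosSemidef →
        Filter.Tendsto (fun k => SignGame.V A B Q R γ k x Z) Filter.atTop
          (nhds ((SignGame.Vstar A Q γ P x Z : ℝ) : EReal))) := by
  have hadm := hP.isAdmissible
  have hfix := hP.riccatiOp_eq (SignGame.isSymm_of_posDef hQ) hR
  have hTopen := SignGame.Tmat_eq_openLoop A Q hγ.ne' hP.1.isUnit hadm.2.isUnit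
  have hD := SignGame.posDef_openLoop_sub hadm (SignGame.isSymm_of_posDef hQ) hR hfix
    (hTopen ▸ hT)
  obtain rfl := hK.eq_gain hadm hR
  have hsuper (hII : SignGame.ConditionII A B Q γ P (SignGame.gain A B R γ P)) :=
    hII.isSupersolution hadm hR hA hγ.ne' hfix hTopen hD
  refine ⟨⟨fun hI => hI.conditionII hadm hR hA hγ.ne' hfix hTopen hD,
    fun hII => (hsuper hII).conditionI hadm hQ.posSemidef hR hfix hTopen⟩,
    fun _ hII hleast => ⟨(hsuper hII).isOptimal_satLaw hQ hR hleast hTopen, fun x Z hZ => ?_⟩⟩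
  rw [SignGame.Vstar_eq hTopen hfix x (SignGame.isSymm_of_posSemidef hZ)]
  exact (hsuper hII).tendsto_V hQ hR hleast x Z hZ
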